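/- **Setting.** An $L$-density is a symmetric Borel probability measure $c$ on $\overline{\mathbb R}=[-\infty,\infty]$, i.e. $c(-E)=\int_E e^{-y}\,c(dy)$ for every Borel $E\subseteq(-\infty,\infty]$ (with $e^{-\infty}=0$). Let $\Delta_0,\Delta_\infty$ be the point masses at $0$ and $+\infty$, and $H(c)=\int\log_2(1+e^{-y})\,c(dy)$. For independent $X\sim c_1$, $Y\sim c_2$, let $c_1\circledast c_2$ be the law of $X+Y$ and $c_1\boxast c_2$ the law of $2\tanh^{-1}(\tanh(X/2)\tanh(Y/2))$; empty $\circledast$- and $\boxast$-products are $\Delta_0$ and $\Delta_\infty$ respectively. Write $c_1\succeq c_2$ if $\int f(|\tanh(y/2)|)\,c_1(dy)\ge\int f(|\tanh(y/2)|)\,c_2(dy)$ for all concave non-increasing $f:[0,1]\to\mathbb R$, and $c_1\succ c_2$ if moreover $c_1\neq c_2$. Let $G$ be a finite bipartite factor graph with $N$ variable nodes $i$, check nodes $\alpha$, edges $(i,\alpha)$ and neighbourhoods $N(\cdot)$; let $\boldsymbol c=(c_i)_i$ be $L$-densities of the channel messages, one per variable node, and let $K$ be a (possibly empty) set of variable nodes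 (information and frozen bits of a polar code; for LDPC codes $K=\emptyset$). Let $S=(s_1,\dots,s_p)$ be a scheduling policy, i.e. a finite sequence of directed edges of $G$. Put $c^{(0)}_{(\alpha,i)}=c^{(0)}_{(i,\alpha)}=\Delta_0$ on all edges. At step $t$ ($1\le t\le p$) only the density on the directed edge $s_t$ changes: if $s_t=\alpha\to i$ (C2V), then $c^{(t)}_{(\alpha,i)}=\boxast_{j\in N(\alpha)\setminus i}c^{(t-1)}_{(j,\alpha)}$; if $s_t=i\to\alpha$ (V2C), then $c^{(t)}_{(i,\alpha)}=\Delta_\infty$ if $i\in K$, and $c^{(t)}_{(i,\alpha)}=c_i\circledast\bigl(\circledast_{h\in N(i)\setminus\alpha}c^{(t-1)}_{(h,i)}\bigr)$ otherwise. Define $$U(\boldsymbol c,t)=-\frac1N\Bigl\{\sum_i H\bigl(c_i\circledast(\circledast_{\alpha\in N(i)}c^{(t)}_{(\alpha,i)})\bigr)+\sum_\alpha\sum_{i\in N(\alpha)}H\bigl(c^{(t)}_{(i,\alpha)}\bigr)-\sum_\alpha H\bigl(\boxast_{i\in N(\alpha)}c^{(t)}_{(i,\alpha)}\bigr)-\sum_{(i,\alpha)}H\bigl(c^{(t)}_{(i,\alpha)}\circledast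 c^{(t)}_{(\alpha,i)}\bigr)\Bigr\}.$$ **Claim.** Let $1\le t\le p$. If the $t$-th message is C2V, on the edge $\alpha\to i$, then $U(\boldsymbol c,t)<U(\boldsymbol c,t-1)$ if and only if $$c^{(t-1)}_{(\alpha,i)}\succ c^{(t)}_{(\alpha,i)}\quad\text{and}\quad c^{(t-1)}_{(i,\alpha)}\succ c_i\circledast\Bigl(\circledast_{h\in N(i)\setminus\alpha}c^{(t-1)}_{(h,i)}\Bigr).$$ If the $t$-th message is V2C, on the edge $i\to\alpha$, then $U(\boldsymbol c,t)<U(\boldsymbol c,t-1)$ if and only if $$c^{(t-1)}_{(i,\alpha)}\succ c^{(t)}_{(i,\alpha)}\quad\text{and}\quad c^{(t-1)}_{(\alpha,i)}\succ\boxast_{j\in N(\alpha)\setminus i}c^{(t-1)}_{(j,\alpha)}.$$ -/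

import Mathlib

open MeasureTheory

namespace DensityEvolution

noncomputable section

/-! ### Log-likelihood ratios on the extended real line -/

/-- `tanh (x / 2)` on the extended reals, with the values `-1` at `-∞` and `1` at `+∞`. -/
def tanhHalf (x : EReal) : ℝ :=
  if x = ⊥ then -1 else if x = ⊤ then 1 else Real.tanh (x.toReal / 2)

/-- `2 tanh⁻¹ u` for `u ∈ [-1, 1]`, with the values `-∞` at `-1` and `+∞` at `1`. -/
def twoArtanh (u : ℝ) : EReal :=
  if u ≤ -1 then ⊥ else if 1 ≤ u then ⊤ else ((2 * Real.artanh u : ℝ) : EReal)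

/-- The check-node rule for two log-likelihood ratios: `2 tanh⁻¹ (tanh (x/2) tanh (y/2))`. -/
def boxOp (x y : EReal) : EReal := twoArtanh (tanhHalf x * tanhHalf y)

theorem tanhHalf_mem (x : EReal) : -1 ≤ tanhHalf x ∧ tanhHalf x ≤ 1 := by
  unfold tanhHalf
  split_ifs
  · norm_num
  · norm_num
  · exact ⟨(Real.neg_one_lt_tanh _).le, (Real.tanh_lt_one _).le⟩

theorem tanhHalf_twoArtanh {u : ℝ} (h₁ : -1 ≤ u) (h₂ : u ≤ 1) : tanhHalf (twoArtanh u) = u := by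
  unfold twoArtanh
  split_ifs with h h'
  · simp [tanhHalf]; linarith
  · simp [tanhHalf]; linarith
  · simp only [tanhHalf, EReal.coe_ne_bot, EReal.coe_ne_top, if_false, EReal.toReal_coe]
    rw [mul_div_cancel_left₀ _ (two_ne_zero), Real.tanh_artanh ⟨by linarith, by linarith⟩]

theorem tanhHalf_boxOp (x y : EReal) : tanhHalf (boxOp x y) = tanhHalf x * tanhHalf y := by
  have hx := abs_le.2 (tanhHalf_mem x)
  have hy := abs_le.2 (tanhHalf_mem y)
  have h : |tanhHalf x * tanhHalf y| ≤ 1 := by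
    rw [abs_mul]; exact mul_le_one₀ hx (abs_nonneg _) hy
  exact tanhHalf_twoArtanh (abs_le.1 h).1 (abs_le.1 h).2

theorem boxOp_comm (x y : EReal) : boxOp x y = boxOp y x := by
  unfold boxOp; rw [mul_comm]

theorem boxOp_assoc (x y z : EReal) : boxOp (boxOp x y) z = boxOp x (boxOp y z) := by
  rw [boxOp, tanhHalf_boxOp, boxOp, tanhHalf_boxOp, mul_assoc]

theorem measurable_tanhHalf : Measurable tanhHalf := by
  apply EReal.measurable_of_measurable_real
  have : (fun p : ℝ => tanhHalf (p : EReal)) = fun p : ℝ => Real.tanh (p / 2) := by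
    funext p; simp [tanhHalf]
  rw [this]
  simp only [Real.tanh_eq_sinh_div_cosh]
  fun_prop

theorem measurable_twoArtanh : Measurable twoArtanh := by
  unfold twoArtanh
  refine Measurable.ite measurableSet_Iic measurable_const
    (Measurable.ite measurableSet_Ici measurable_const ?_)
  apply Measurable.coe_real_ereal
  unfold Real.artanh
  fun_prop

theorem measurable_boxOp : Measurable fun p : EReal × EReal => boxOp p.1 p.2 :=
  measurable_twoArtanh.comp
    ((measurable_tanhHalf.comp measurable_fst).mul (measurable_tanhHalf.comp measurable_snd))

/-! ### `L`-densities -/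

/-- Probability measures on the extended reals, the carrier of all `L`-densities. -/
abbrev LDensity := ProbabilityMeasure EReal

/-- A probability measure on the extended reals is symmetric if `c (-E) = ∫_E e^{-y} c(dy)` for
every Borel set `E` of points different from `-∞`. In particular `c {-∞} = 0`. These measures are
the `L`-densities of binary memoryless symmetric channels. -/
def IsSymmetric (c : LDensity) : Prop :=
  ∀ E : Set EReal, MeasurableSet E → ⊥ ∉ E →
    (c : Measure EReal) (Neg.neg ⁻¹' E) = ∫⁻ y in E, EReal.exp (-y) ∂(c : Measure EReal)

/-- The point mass at `0` (the uninformative message). -/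
def deltaZero : LDensity := ⟨Measure.dirac 0, inferInstance⟩

/-- The point mass at `+∞` (the perfectly informative message). -/
def deltaTop : LDensity := ⟨Measure.dirac ⊤, inferInstance⟩

/-- `log₂ (1 + e^{-y})` for real `y`, with its limit `0` at `+∞`. The point `-∞` carries no mass
under a symmetric measure, so the value chosen there is irrelevant. -/
def entropyKernel (y : EReal) : ℝ :=
  if y = ⊥ ∨ y = ⊤ then 0 else Real.logb 2 (1 + Real.exp (-y.toReal))

/-- The entropy functional `H(c) = ∫ log₂ (1 + e^{-y}) c(dy)`. -/
def entropy (c : LDensity) : ℝ := ∫ y, entropyKernel y ∂(c : Measure EReal)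

/-- `I_f(c) = ∫ f(|tanh(y/2)|) c(dy)`. -/
def degradationIntegral (f : ℝ → ℝ) (c : LDensity) : ℝ :=
  ∫ y, f |tanhHalf y| ∂(c : Measure EReal)

/-- `c₁ ⪰ c₂`: `c₁` is degraded with respect to `c₂`. -/
def Degraded (c₁ c₂ : LDensity) : Prop :=
  ∀ f : ℝ → ℝ, ConcaveOn ℝ (Set.Icc 0 1) f → AntitoneOn f (Set.Icc 0 1) →
    degradationIntegral f c₂ ≤ degradationIntegral f c₁

/-- `c₁ ≻ c₂`: `c₁` is strictly degraded with respect to `c₂`. -/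
def StrictlyDegraded (c₁ c₂ : LDensity) : Prop := Degraded c₁ c₂ ∧ c₁ ≠ c₂

/-- Variable-node convolution `c₁ ⊛ c₂`: the law of `X + Y` for independent `X ∼ c₁`, `Y ∼ c₂`. -/
def vnConv (c₁ c₂ : LDensity) : LDensity :=
  ⟨((c₁ : Measure EReal).prod (c₂ : Measure EReal)).map fun p => p.1 + p.2,
    Measure.isProbabilityMeasure_map (measurable_fst.add measurable_snd).aemeasurable⟩

/-- Check-node convolution `c₁ ⊠ c₂`: the law of `2 tanh⁻¹ (tanh (X/2) tanh (Y/2))` for independent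
`X ∼ c₁`, `Y ∼ c₂`. -/
def cnConv (c₁ c₂ : LDensity) : LDensity :=
  ⟨((c₁ : Measure EReal).prod (c₂ : Measure EReal)).map fun p => boxOp p.1 p.2,
    Measure.isProbabilityMeasure_map measurable_boxOp.aemeasurable⟩

theorem map_prod_comm (op : EReal → EReal → EReal)
    (hop : Measurable fun p : EReal × EReal => op p.1 p.2) (hc : ∀ x y, op x y = op y x)
    (μ ν : Measure EReal) [SFinite μ] [SFinite ν] :
    (μ.prod ν).map (fun p => op p.1 p.2) = (ν.prod μ).map (fun p => op p.1 p.2) := by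
  rw [← Measure.prod_swap, Measure.map_map hop measurable_swap]
  congr 1
  funext p
  exact hc _ _

theorem map_prod_assoc (op : EReal → EReal → EReal)
    (hop : Measurable fun p : EReal × EReal => op p.1 p.2)
    (ha : ∀ x y z, op (op x y) z = op x (op y z))
    (μ ν ρ : Measure EReal) [SFinite μ] [SFinite ν] [SFinite ρ] :
    (((μ.prod ν).map fun p => op p.1 p.2).prod ρ).map (fun p => op p.1 p.2) =
      (μ.prod ((ν.prod ρ).map fun p => op p.1 p.2)).map (fun p => op p.1 p.2) := by
  have e₁ := Measure.map_prod_map (μ.prod ν) ρ hop measurable_id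
  have e₂ := Measure.map_prod_map μ (ν.prod ρ) measurable_id hop
  rw [Measure.map_id] at e₁ e₂
  rw [e₁, e₂, Measure.map_map hop (hop.prodMap measurable_id),
    Measure.map_map hop (measurable_id.prodMap hop), ← Measure.prodAssoc_prod,
    Measure.map_map (hop.comp (measurable_id.prodMap hop)) MeasurableEquiv.prodAssoc.measurable]
  congr 1
  funext p
  exact ha _ _ _

instance vnConv_commutative : Std.Commutative vnConv :=
  ⟨fun c₁ c₂ => Subtype.ext
    (map_prod_comm (· + ·) (measurable_fst.add measurable_snd) add_comm c₁ c₂)⟩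

instance vnConv_associative : Std.Associative vnConv :=
  ⟨fun c₁ c₂ c₃ => Subtype.ext
    (map_prod_assoc (· + ·) (measurable_fst.add measurable_snd) add_assoc c₁ c₂ c₃)⟩

instance cnConv_commutative : Std.Commutative cnConv :=
  ⟨fun c₁ c₂ => Subtype.ext (map_prod_comm boxOp measurable_boxOp boxOp_comm c₁ c₂)⟩

instance cnConv_associative : Std.Associative cnConv :=
  ⟨fun c₁ c₂ c₃ => Subtype.ext (map_prod_assoc boxOp measurable_boxOp boxOp_assoc c₁ c₂ c₃)⟩

/-- The iterated convolution `⊛_{j ∈ s} a_j`; the empty one is `Δ_0`, the unit of `⊛`. -/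
def vnConvs {ι : Type*} (s : Finset ι) (a : ι → LDensity) : LDensity :=
  s.fold vnConv deltaZero a

/-- The iterated convolution `⊠_{j ∈ s} a_j`; the empty one is `Δ_∞`, the unit of `⊠`. -/
def cnConvs {ι : Type*} (s : Finset ι) (a : ι → LDensity) : LDensity :=
  s.fold cnConv deltaTop a

/-! ### Factor graphs, schedules and density evolution -/

/-- A factor graph with variable nodes `V` and check nodes `C`. The members of `known` are the
variable nodes of a polar code's factor graph (its information and frozen bits) whose outgoing
messages are perfectly informative; for an LDPC code `known` is empty. -/
structure FactorGraph (V C : Type*) where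
  edges : Finset (V × C)
  known : Finset V

variable {V C : Type*} [Fintype V] [DecidableEq V] [Fintype C] [DecidableEq C]

/-- The neighbourhood `N(i)` of a variable node. -/
def FactorGraph.nbrV (G : FactorGraph V C) (i : V) : Finset C :=
  Finset.univ.filter fun α => (i, α) ∈ G.edges

/-- The neighbourhood `N(α)` of a check node. -/
def FactorGraph.nbrC (G : FactorGraph V C) (α : C) : Finset V :=
  Finset.univ.filter fun i => (i, α) ∈ G.edges

/-- The directed edges of a factor graph: `c2v α i` is the edge from the check node `α` to the
variable node `i`, and `v2c i α` is the opposite one. -/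
inductive DirectedEdge (G : FactorGraph V C) where
  | c2v (α : C) (i : V) (h : (i, α) ∈ G.edges)
  | v2c (i : V) (α : C) (h : (i, α) ∈ G.edges)

/-- A scheduling policy is a finite sequence of directed edges. -/
abbrev Schedule (G : FactorGraph V C) := List (DirectedEdge G)

/-- The `L`-densities of all current messages. Only the entries at edges of the graph matter. -/
structure Messages (V C : Type*) where
  c2v : C → V → LDensity
  v2c : V → C → LDensity

/-- The initial messages: all equal to `Δ_0`. -/
def initialMessages (V C : Type*) : Messages V C := ⟨fun _ _ => deltaZero, fun _ _ => deltaZero⟩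

/-- The updated check-to-variable density `⊠_{j ∈ N(α) \ i} c_{(j,α)}`. -/
def c2vUpdate (G : FactorGraph V C) (m : Messages V C) (α : C) (i : V) : LDensity :=
  cnConvs (G.nbrC α \ {i}) fun j => m.v2c j α

/-- The density `c_i ⊛ (⊛_{h ∈ N(i) \ α} c_{(h,i)})`. -/
def extrinsic (G : FactorGraph V C) (c : V → LDensity) (m : Messages V C) (i : V) (α : C) :
    LDensity :=
  vnConv (c i) (vnConvs (G.nbrV i \ {α}) fun h => m.c2v h i)

/-- The updated variable-to-check density. -/
def v2cUpdate (G : FactorGraph V C) (c : V → LDensity) (m : Messages V C) (i : V) (α : C) :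
    LDensity :=
  if i ∈ G.known then deltaTop else extrinsic G c m i α

/-- Passing one message: only the density on the given directed edge is updated. -/
def passMessage (G : FactorGraph V C) (c : V → LDensity) (m : Messages V C) :
    DirectedEdge G → Messages V C
  | .c2v α i _ =>
      { m with c2v := Function.update m.c2v α (Function.update (m.c2v α) i (c2vUpdate G m α i)) }
  | .v2c i α _ =>
      { m with v2c := Function.update m.v2c i (Function.update (m.v2c i) α (v2cUpdate G c m i α)) }

/-- The message densities after the first `t` messages of the schedule have been passed. -/
def messagesAt (G : FactorGraph V C) (c : V → LDensity) (S : Schedule G) (t : ℕ) : Messages V C :=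
  (S.take t).foldl (passMessage G c) (initialMessages V C)

/-- The gap to maximum a posteriori `U(c, t)` (for the graph `G` and the schedule `S`). -/
def gap (G : FactorGraph V C) (c : V → LDensity) (S : Schedule G) (t : ℕ) : ℝ :=
  let m : Messages V C := messagesAt G c S t;
  (-1 / (Fintype.card V : ℝ)) *
    ((∑ i, entropy (vnConv (c i) (vnConvs (G.nbrV i) fun α => m.c2v α i)))
      + (∑ α, ∑ i ∈ G.nbrC α, entropy (m.v2c i α))
      - (∑ α, entropy (cnConvs (G.nbrC α) fun i => m.v2c i α))
      - ∑ e ∈ G.edges, entropy (vnConv (m.v2c e.1 e.2) (m.c2v e.2 e.1)))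

end

end DensityEvolution

open DensityEvolution

/-! In the variable `u = tanh (y / 2)` an `L`-density becomes a law `μ` on `[-1, 1]` for which `(1 -
u) μ(du)` is even, `⊠` becomes multiplication of independent variables, and `H = 1 - (∫ infoGain dμ)
/ log 2`. The power series of `infoGain` has only even powers and positive coefficients, so `log 2 *
(1 - H(a ⊠ b))` is a positively weighted sum of products `m_k(a) m_k(b)` of even moments. The
duality rule `H(a ⊛ b) + H(a ⊠ b) = H(a) + H(b)` carries this over to `⊛`: up to the factor `log 2`,
the second difference `H(a' ⊛ b') - H(a' ⊛ b) - H(a ⊛ b') + H(a ⊛ b)` is the sum of the terms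
`infoCoeff k * (m_k(a') - m_k(a)) * (m_k(b') - m_k(b))` (`hasSum_entropy_vnConv`).

Degradation orders all even moments, and comparable densities with equal second moments coincide
(`Degraded.eq_of_evenMoment_zero`). So if `a ⪰ a'` and `b`, `b'` are comparable in either direction,
the second difference is positive exactly when `a ≻ a'` and `b ≻ b'`
(`entropy_vnConv_second_difference_pos_iff`).

Passing one message changes `-N U` by exactly such a second difference: one pair is the old and new
density of the message, the other is the opposite message on the same edge and the convolution of
what currently enters its tail. The first pair is ordered because both convolutions are monotone, so
that every update improves on the current density throughout the schedule (`Messages.IsAdmissible`).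
The second pair is comparable for the same reason, or, at a known variable node, because its
messages are always `Δ_0` or `Δ_∞`, the extremes of the order. -/

namespace DensityEvolution

open Filter Topology Set

/-! ### The binary entropy function in the `tanh` domain -/

/-- `((1 + w) log (1 + w) + (1 - w) log (1 - w)) / 2`: the entropy, in nats, that a binary symmetric
channel with `|tanh (y/2)| = w` removes. -/
noncomputable def infoGain (w : ℝ) : ℝ :=
  ((1 + w) * Real.log (1 + w) + (1 - w) * Real.log (1 - w)) / 2

/-- The Taylor coefficients of `infoGain`. -/
noncomputable def infoCoeff (k : ℕ) : ℝ := 1 / ((2 * k + 1) * (2 * k + 2))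

theorem infoCoeff_pos (k : ℕ) : 0 < infoCoeff k := by unfold infoCoeff; positivity

theorem summable_infoCoeff : Summable infoCoeff := by
  have h : Summable fun k : ℕ => 1 / (((k + 1 : ℕ) : ℝ)) ^ 2 :=
    (summable_nat_add_iff 1).2 (Real.summable_one_div_nat_pow.2 one_lt_two)
  refine Summable.of_nonneg_of_le (fun k => (infoCoeff_pos k).le) (fun k => ?_) h
  unfold infoCoeff
  push_cast
  gcongr
  have : (0 : ℝ) ≤ k := k.cast_nonneg
  nlinarith

theorem infoGain_eq_mul_log (w : ℝ) : infoGain w =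
    -(Real.negMulLog (1 + w) + Real.negMulLog (1 - w)) / 2 := by
  unfold infoGain Real.negMulLog; ring

theorem continuous_infoGain : Continuous infoGain := by
  have : infoGain = fun w => -(Real.negMulLog (1 + w) + Real.negMulLog (1 - w)) / 2 :=
    funext infoGain_eq_mul_log
  rw [this]
  fun_prop

theorem infoGain_neg (w : ℝ) : infoGain (-w) = infoGain w := by
  unfold infoGain; rw [sub_neg_eq_add, ← sub_eq_add_neg]; ring

theorem norm_infoCoeff_mul_pow_le {w : ℝ} (hw : |w| ≤ 1) (k : ℕ) :
    ‖infoCoeff k * w ^ (2 * k + 2)‖ ≤ infoCoeff k := by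
  rw [norm_mul, norm_pow, Real.norm_eq_abs, Real.norm_eq_abs, abs_of_pos (infoCoeff_pos k)]
  exact mul_le_of_le_one_right (infoCoeff_pos k).le (pow_le_one₀ (abs_nonneg _) hw)

/-- Write `infoGain w` as `w/2 * (log (1 + w) - log (1 - w)) + log (1 - w²) / 2` and subtract the
two logarithm series; the coefficient is `1 / (2k+1) - 1 / (2k+2)`. -/
theorem hasSum_infoGain_of_abs_lt_one {w : ℝ} (hw : |w| < 1) :
    HasSum (fun k : ℕ => infoCoeff k * w ^ (2 * k + 2)) (infoGain w) := by
  have h1 := (Real.hasSum_log_sub_log_of_abs_lt_one hw).mul_left (w / 2)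
  have hw2 : |w ^ 2| < 1 := by rw [abs_pow]; exact pow_lt_one₀ (abs_nonneg _) hw two_ne_zero
  have h2 := (Real.hasSum_pow_div_log_of_abs_lt_one hw2).mul_left (1 / 2)
  have h := h1.sub h2
  obtain ⟨ha, hb⟩ := abs_lt.1 hw
  have e : Real.log (1 - w ^ 2) = Real.log (1 + w) + Real.log (1 - w) := by
    rw [← Real.log_mul (by linarith) (by linarith)]; congr 1; ring
  have e1 : (fun k : ℕ => infoCoeff k * w ^ (2 * k + 2)) = fun k : ℕ =>
      w / 2 * (2 * (1 / (2 * k + 1)) * w ^ (2 * k + 1)) -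
        1 / 2 * ((w ^ 2) ^ (k + 1) / (k + 1)) := by
    funext k
    have : (2 * (k : ℝ) + 1) ≠ 0 := by positivity
    have : ((k : ℝ) + 1) ≠ 0 := by positivity
    have : (2 * (k : ℝ) + 2) ≠ 0 := by positivity
    unfold infoCoeff
    rw [← pow_mul]
    field_simp
    ring
  have e2 : infoGain w = w / 2 * (Real.log (1 + w) - Real.log (1 - w)) -
      1 / 2 * -Real.log (1 - w ^ 2) := by
    unfold infoGain; rw [e]; ring
  rw [e1, e2]
  exact h

/-- The endpoints follow by an Abel-type limit: at `x * w` both sides are continuous in `x ∈ [0,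
1]`, since `infoCoeff` is a summable majorant, and they agree for `x < 1`. -/
theorem hasSum_infoGain {w : ℝ} (hw : |w| ≤ 1) :
    HasSum (fun k : ℕ => infoCoeff k * w ^ (2 * k + 2)) (infoGain w) := by
  have hs : Summable fun k : ℕ => infoCoeff k * w ^ (2 * k + 2) :=
    Summable.of_norm_bounded summable_infoCoeff (norm_infoCoeff_mul_pow_le hw)
  have hb : ∀ (k : ℕ) (x : Icc (0 : ℝ) 1),
      ‖infoCoeff k * ((x : ℝ) * w) ^ (2 * k + 2)‖ ≤ infoCoeff k := fun k x =>
    norm_infoCoeff_mul_pow_le (by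
      rw [abs_mul, abs_of_nonneg x.2.1]; exact mul_le_one₀ x.2.2 (abs_nonneg _) hw) k
  have hc : Continuous fun x : Icc (0 : ℝ) 1 =>
      ∑' k : ℕ, infoCoeff k * ((x : ℝ) * w) ^ (2 * k + 2) :=
    continuous_tsum (fun k => by fun_prop) summable_infoCoeff hb
  have hc' : Continuous fun x : Icc (0 : ℝ) 1 => infoGain ((x : ℝ) * w) :=
    continuous_infoGain.comp (by fun_prop)
  let z : ℕ → Icc (0 : ℝ) 1 := fun n => ⟨1 - 1 / ((n : ℝ) + 1), by
    have h0 : (0 : ℝ) < (n : ℝ) + 1 := by positivity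
    constructor
    · rw [sub_nonneg, div_le_one h0]; linarith [(n.cast_nonneg : (0 : ℝ) ≤ n)]
    · have : 0 < 1 / ((n : ℝ) + 1) := by positivity
      linarith⟩
  have hz : Tendsto z atTop (𝓝 ⟨1, by simp⟩) := by
    rw [tendsto_subtype_rng]
    simpa [z] using (tendsto_one_div_add_atTop_nhds_zero_nat (𝕜 := ℝ)).const_sub 1
  have he : ∀ n, (∑' k : ℕ, infoCoeff k * ((z n : ℝ) * w) ^ (2 * k + 2)) =
      infoGain ((z n : ℝ) * w) := fun n => by
    refine (hasSum_infoGain_of_abs_lt_one ?_).tsum_eq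
    have h0 : (0 : ℝ) < 1 / ((n : ℝ) + 1) := by positivity
    have h1 : (z n : ℝ) < 1 := by
      change 1 - 1 / ((n : ℝ) + 1) < 1
      linarith
    rw [abs_mul, abs_of_nonneg (z n).2.1]
    calc (z n : ℝ) * |w| ≤ z n * 1 := by gcongr; exact (z n).2.1
      _ < 1 := by linarith
  have t1 := (hc.tendsto _).comp hz
  have t2 := (hc'.tendsto _).comp hz
  have := tendsto_nhds_unique (t1.congr he) t2
  simp only [one_mul] at this
  rw [← this]
  exact hs.hasSum

/-! ### The addition law of `tanh` -/

/-- `tanh ((x + y) / 2)` as a function of `tanh (x / 2)` and `tanh (y / 2)`; the value at `u v = -1`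
accounts for `⊤ + ⊥ = ⊥`. -/
noncomputable def tanhAdd (u v : ℝ) : ℝ := if u * v = -1 then -1 else (u + v) / (1 + u * v)

theorem tanhAdd_comm (u v : ℝ) : tanhAdd u v = tanhAdd v u := by
  unfold tanhAdd; rw [mul_comm, add_comm u]

theorem measurable_tanhAdd : Measurable fun p : ℝ × ℝ => tanhAdd p.1 p.2 := by
  unfold tanhAdd
  refine Measurable.ite ?_ measurable_const (by fun_prop)
  exact (measurable_fst.mul measurable_snd) (measurableSet_singleton (-1 : ℝ))

theorem abs_mul_le_one {u v : ℝ} (hu : |u| ≤ 1) (hv : |v| ≤ 1) : |u * v| ≤ 1 := by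
  rw [abs_mul]; exact mul_le_one₀ hu (abs_nonneg _) hv

theorem one_add_mul_nonneg {u v : ℝ} (hu : |u| ≤ 1) (hv : |v| ≤ 1) : 0 ≤ 1 + u * v := by
  linarith [(abs_le.1 (abs_mul_le_one hu hv)).1]

/-- The division-free addition law survives the degenerate case: if `u v = -1`, the nonnegative
products `(1 + u)(1 + v)` and `(1 - u)(1 - v)` equal `±(u + v)`, so `u + v = 0`. -/
theorem one_add_mul_mul_tanhAdd {u v : ℝ} (hu : |u| ≤ 1) (hv : |v| ≤ 1) :
    (1 + u * v) * tanhAdd u v = u + v := by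
  unfold tanhAdd
  obtain ⟨h1, h2⟩ := abs_le.1 hu
  obtain ⟨h3, h4⟩ := abs_le.1 hv
  split_ifs with h
  · have h5 : (1 + u) * (1 + v) = u + v := by linear_combination h
    have h6 : (1 - u) * (1 - v) = -(u + v) := by linear_combination h
    have h7 : 0 ≤ (1 + u) * (1 + v) := mul_nonneg (by linarith) (by linarith)
    have h8 : 0 ≤ (1 - u) * (1 - v) := mul_nonneg (by linarith) (by linarith)
    rw [h]; linarith
  · exact mul_div_cancel₀ _ (fun h' => h (by linarith))

theorem one_add_mul_mul_one_add_tanhAdd {u v : ℝ} (hu : |u| ≤ 1) (hv : |v| ≤ 1) :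
    (1 + u * v) * (1 + tanhAdd u v) = (1 + u) * (1 + v) := by
  linear_combination one_add_mul_mul_tanhAdd hu hv

theorem one_add_mul_mul_one_sub_tanhAdd {u v : ℝ} (hu : |u| ≤ 1) (hv : |v| ≤ 1) :
    (1 + u * v) * (1 - tanhAdd u v) = (1 - u) * (1 - v) := by
  linear_combination -one_add_mul_mul_tanhAdd hu hv

/-- The convention `⊤ + ⊥ = ⊥` breaks oddness at `u v = -1`. This is harmless later because the
point always enters with a weight that vanishes there. -/
theorem tanhAdd_neg_neg {u v : ℝ} (h : u * v ≠ -1) : tanhAdd (-u) (-v) = -tanhAdd u v := by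
  unfold tanhAdd
  rw [neg_mul_neg, if_neg h, if_neg h]; ring

theorem abs_tanhAdd_le {u v : ℝ} (hu : |u| ≤ 1) (hv : |v| ≤ 1) : |tanhAdd u v| ≤ 1 := by
  by_cases h : u * v = -1
  · simp [tanhAdd, h]
  · have hp : 0 < 1 + u * v := lt_of_le_of_ne (one_add_mul_nonneg hu hv) (fun h' => h (by linarith))
    obtain ⟨h1, h2⟩ := abs_le.1 hu
    obtain ⟨h3, h4⟩ := abs_le.1 hv
    have h5 : 0 ≤ (1 + u * v) * (1 + tanhAdd u v) := by
      rw [one_add_mul_mul_one_add_tanhAdd hu hv]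
      exact mul_nonneg (by linarith) (by linarith)
    have h6 : 0 ≤ (1 + u * v) * (1 - tanhAdd u v) := by
      rw [one_add_mul_mul_one_sub_tanhAdd hu hv]
      exact mul_nonneg (by linarith) (by linarith)
    rw [abs_le]
    constructor
    · linarith [nonneg_of_mul_nonneg_right h5 hp]
    · linarith [nonneg_of_mul_nonneg_right h6 hp]

/-- This is `log w = log x + log y - log z`, multiplied by `z w = x y` so that zero factors are
allowed: when `x y = 0` both sides vanish. -/
theorem mul_log_of_mul_eq {x y z w : ℝ} (h : z * w = x * y) :
    z * (w * Real.log w) = x * y * (Real.log x + Real.log y - Real.log z) := by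
  rcases eq_or_ne x 0 with rfl | hx
  · rcases eq_or_ne z 0 with rfl | hz
    · simp
    · have : w = 0 := by simpa [hz] using h
      simp [this]
  rcases eq_or_ne y 0 with rfl | hy
  · rcases eq_or_ne z 0 with rfl | hz
    · simp
    · have : w = 0 := by simpa [hz] using h
      simp [this]
  have hzw : z * w ≠ 0 := by rw [h]; exact mul_ne_zero hx hy
  have hl := congrArg Real.log h
  rw [Real.log_mul (left_ne_zero_of_mul hzw) (right_ne_zero_of_mul hzw), Real.log_mul hx hy] at hl
  rw [← mul_assoc, h]
  congr 1
  linarith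

theorem one_add_mul_mul_infoGain_tanhAdd {u v : ℝ} (hu : |u| ≤ 1) (hv : |v| ≤ 1) :
    (1 + u * v) * infoGain (tanhAdd u v) =
      ((1 + u) * (1 + v) * (Real.log (1 + u) + Real.log (1 + v) - Real.log (1 + u * v)) +
        (1 - u) * (1 - v) * (Real.log (1 - u) + Real.log (1 - v) - Real.log (1 + u * v))) / 2 := by
  have h1 := mul_log_of_mul_eq (one_add_mul_mul_one_add_tanhAdd hu hv)
  have h2 := mul_log_of_mul_eq (one_add_mul_mul_one_sub_tanhAdd hu hv)
  unfold infoGain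
  linear_combination h1 / 2 + h2 / 2

/-- The chain rule for the entropies of two binary symmetric channels. -/
theorem infoGain_tanhAdd_add_infoGain_mul {u v : ℝ} (hu : |u| ≤ 1) (hv : |v| ≤ 1) :
    (1 + u * v) / 2 * infoGain (tanhAdd u v) + (1 - u * v) / 2 * infoGain (tanhAdd u (-v)) +
      infoGain (u * v) = infoGain u + infoGain v := by
  have h1 := one_add_mul_mul_infoGain_tanhAdd hu hv
  have h2 := one_add_mul_mul_infoGain_tanhAdd hu ((abs_neg v).trans_le hv)
  simp only [mul_neg, sub_neg_eq_add, ← sub_eq_add_neg] at h2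
  unfold infoGain at *
  linear_combination h1 / 2 + h2 / 2

/-! ### Concavity of the two convolution kernels -/

/-- The expectation of an even function `F` of `tanh (Z / 2)` for the sum `Z` of the log-likelihood
ratios of two binary symmetric channels. -/
noncomputable def vnKernel (F : ℝ → ℝ) (u v : ℝ) : ℝ :=
  (1 + u * v) / 2 * F (tanhAdd u v) + (1 - u * v) / 2 * F (tanhAdd u (-v))

theorem abs_le_one_of_convex_comb {x y a b : ℝ} (hx : |x| ≤ 1) (hy : |y| ≤ 1) (ha : 0 ≤ a)
    (hb : 0 ≤ b) (hab : a + b = 1) : |a * x + b * y| ≤ 1 := by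
  obtain ⟨h1, h2⟩ := abs_le.1 hx
  obtain ⟨h3, h4⟩ := abs_le.1 hy
  rw [abs_le]
  constructor <;> nlinarith

/-- A perspective of `F`: both `1 + u v` and `(1 + u v) * tanhAdd u v = u + v` are affine in `u`, so
Jensen applies with the weights `a` and `b` rescaled by `1 + x v` and `1 + y v`. -/
theorem concaveOn_one_add_mul_mul_comp_tanhAdd {F : ℝ → ℝ} (hF : ConcaveOn ℝ (Icc (-1) 1) F) {v : ℝ}
    (hv : |v| ≤ 1) : ConcaveOn ℝ (Icc (-1) 1) fun u => (1 + u * v) * F (tanhAdd u v) := by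
  refine ⟨convex_Icc _ _, fun x hx y hy a b ha hb hab => ?_⟩
  replace hx := abs_le.2 hx
  replace hy := abs_le.2 hy
  simp only [smul_eq_mul]
  set w := a * x + b * y with hw
  have hw1 : |w| ≤ 1 := abs_le_one_of_convex_comb hx hy ha hb hab
  have px := mul_nonneg ha (one_add_mul_nonneg hx hv)
  have py := mul_nonneg hb (one_add_mul_nonneg hy hv)
  have e : 1 + w * v = a * (1 + x * v) + b * (1 + y * v) := by
    rw [hw]; linear_combination -hab
  -- The rescaled weights need `1 + w v > 0`; if it is zero, both nonnegative summands of `1 + w v`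
  -- are zero and the inequality reads `0 ≤ 0`.
  rcases (one_add_mul_nonneg hw1 hv).eq_or_lt with h0 | hpos
  · have h1 : a * (1 + x * v) = 0 := by linarith
    have h2 : b * (1 + y * v) = 0 := by linarith
    rw [← h0, ← mul_assoc, ← mul_assoc, h1, h2]; simp
  · have hne := hpos.ne'
    have key := hF.2 (abs_le.1 (abs_tanhAdd_le hx hv)) (abs_le.1 (abs_tanhAdd_le hy hv))
      (div_nonneg px hpos.le) (div_nonneg py hpos.le) (by rw [← add_div, ← e, div_self hne])
    simp only [smul_eq_mul] at key
    have hs : a * (1 + x * v) / (1 + w * v) * tanhAdd x v +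
        b * (1 + y * v) / (1 + w * v) * tanhAdd y v = tanhAdd w v := by
      apply mul_left_cancel₀ hne
      rw [one_add_mul_mul_tanhAdd hw1 hv]
      field_simp
      linear_combination a * one_add_mul_mul_tanhAdd hx hv + b * one_add_mul_mul_tanhAdd hy hv
        - hw + v * hab
    rw [hs] at key
    have := mul_le_mul_of_nonneg_left key hpos.le
    refine le_trans (le_of_eq ?_) this
    rw [mul_add, div_mul_eq_mul_div, div_mul_eq_mul_div, mul_div_cancel₀ _ hne,
      mul_div_cancel₀ _ hne]
    ring

theorem concaveOn_vnKernel {F : ℝ → ℝ} (hF : ConcaveOn ℝ (Icc (-1) 1) F) {v : ℝ} (hv : |v| ≤ 1) :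
    ConcaveOn ℝ (Icc (-1) 1) fun u => vnKernel F u v := by
  have h1 := (concaveOn_one_add_mul_mul_comp_tanhAdd hF hv).smul (by norm_num : (0 : ℝ) ≤ 1 / 2)
  have h2 := (concaveOn_one_add_mul_mul_comp_tanhAdd hF ((abs_neg v).trans_le hv)).smul
    (by norm_num : (0 : ℝ) ≤ 1 / 2)
  refine (h1.add h2).congr fun u _ => ?_
  simp only [vnKernel, Pi.add_apply, smul_eq_mul]
  ring

theorem vnKernel_neg {F : ℝ → ℝ} (hF : ∀ u, F (-u) = F u) {u v : ℝ} :
    vnKernel F (-u) v = vnKernel F u v := by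
  have h : ∀ a b : ℝ, (1 + a * b) * F (tanhAdd (-a) (-b)) = (1 + a * b) * F (tanhAdd a b) := by
    intro a b
    by_cases hab : a * b = -1
    · simp [hab]
    · rw [tanhAdd_neg_neg hab, hF]
  have h1 := h u (-v)
  have h2 := h u v
  rw [neg_neg] at h1
  simp only [vnKernel]
  linear_combination h1 / 2 + h2 / 2

theorem antitoneOn_of_concaveOn_of_even {F : ℝ → ℝ} (hF : ConcaveOn ℝ (Icc (-1) 1) F)
    (he : ∀ u, F (-u) = F u) : AntitoneOn F (Icc 0 1) := by
  intro x hx y hy hxy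
  rcases hy.1.eq_or_lt with h0 | hpos
  · have : x = y := by linarith [hx.1]
    rw [this]
  · have hy1 : y ∈ Icc (-1 : ℝ) 1 := ⟨by linarith [hy.1], hy.2⟩
    have hy2 : -y ∈ Icc (-1 : ℝ) 1 := ⟨by linarith [hy.2], by linarith [hy.1]⟩
    have h1 : 0 ≤ x / y := div_nonneg hx.1 hy.1
    have h2 : x / y ≤ 1 := (div_le_one hpos).2 hxy
    have key := hF.2 hy1 hy2 (show 0 ≤ (1 + x / y) / 2 by linarith)
      (show 0 ≤ (1 - x / y) / 2 by linarith) (by ring)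
    simp only [smul_eq_mul, he] at key
    have e : (1 + x / y) / 2 * y + (1 - x / y) / 2 * -y = x := by field_simp; ring
    rw [e] at key
    linarith

theorem concaveOn_comp_abs {f : ℝ → ℝ} (hf : ConcaveOn ℝ (Icc 0 1) f)
    (ha : AntitoneOn f (Icc 0 1)) : ConcaveOn ℝ (Icc (-1) 1) fun u => f |u| := by
  refine ⟨convex_Icc _ _, fun x hx y hy a b h1 h2 hab => ?_⟩
  replace hx := abs_le.2 hx
  replace hy := abs_le.2 hy
  have hx' : |x| ∈ Icc (0 : ℝ) 1 := ⟨abs_nonneg _, hx⟩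
  have hy' : |y| ∈ Icc (0 : ℝ) 1 := ⟨abs_nonneg _, hy⟩
  refine (hf.2 hx' hy' h1 h2 hab).trans ?_
  refine ha ⟨abs_nonneg _, abs_le_one_of_convex_comb hx hy h1 h2 hab⟩
    (convex_Icc (0 : ℝ) 1 hx' hy' h1 h2 hab) ?_
  simp only [smul_eq_mul]
  refine (abs_add_le _ _).trans (le_of_eq ?_)
  rw [abs_mul, abs_mul, abs_of_nonneg h1, abs_of_nonneg h2]

/-- Test functions for degradation are stable under convolution with a fixed channel; this and its
check-node analogue below give monotonicity of `⊛` and `⊠`. -/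
theorem concaveOn_antitoneOn_vnKernel {f : ℝ → ℝ} (hf : ConcaveOn ℝ (Icc 0 1) f)
    (ha : AntitoneOn f (Icc 0 1)) {v : ℝ} (hv : |v| ≤ 1) :
    ConcaveOn ℝ (Icc 0 1) (fun u => vnKernel (fun x => f |x|) u v) ∧
      AntitoneOn (fun u => vnKernel (fun x => f |x|) u v) (Icc 0 1) := by
  have h := concaveOn_vnKernel (concaveOn_comp_abs hf ha) hv
  refine ⟨h.subset (Icc_subset_Icc (by norm_num) le_rfl) (convex_Icc _ _), ?_⟩
  exact antitoneOn_of_concaveOn_of_even h fun u => vnKernel_neg (fun x => by simp)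

theorem concaveOn_antitoneOn_comp_mul {f : ℝ → ℝ} (hf : ConcaveOn ℝ (Icc 0 1) f)
    (ha : AntitoneOn f (Icc 0 1)) {v : ℝ} (hv : |v| ≤ 1) :
    ConcaveOn ℝ (Icc 0 1) (fun u => f (u * |v|)) ∧
      AntitoneOn (fun u => f (u * |v|)) (Icc 0 1) := by
  have hm : ∀ u ∈ Icc (0 : ℝ) 1, u * |v| ∈ Icc (0 : ℝ) 1 := fun u hu =>
    ⟨mul_nonneg hu.1 (abs_nonneg _), mul_le_one₀ hu.2 (abs_nonneg _) hv⟩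
  refine ⟨⟨convex_Icc _ _, fun x hx y hy a b h1 h2 hab => ?_⟩, fun x hx y hy hxy => ?_⟩
  · have := hf.2 (hm x hx) (hm y hy) h1 h2 hab
    simp only [smul_eq_mul] at this ⊢
    rwa [show (a * x + b * y) * |v| = a * (x * |v|) + b * (y * |v|) by ring]
  · exact ha (hm x hx) (hm y hy) (by gcongr)

/-! ### Symmetric measures in the `tanh` domain -/

/-- The laws of `tanh (y / 2)` under `L`-densities: probability measures `μ` on `[-1, 1]` for which
the measure `(1 - u) μ(du)` is even. -/
structure IsSymmetricLaw (μ : Measure ℝ) : Prop where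
  isProbabilityMeasure : IsProbabilityMeasure μ
  ae_abs_le : ∀ᵐ u ∂μ, |u| ≤ 1
  map_neg : (μ.withDensity fun u => ENNReal.ofReal (1 - u)).map Neg.neg =
    μ.withDensity fun u => ENNReal.ofReal (1 - u)

theorem measurable_ofReal_one_sub : Measurable fun u : ℝ => ENNReal.ofReal (1 - u) := by fun_prop

theorem integrable_of_abs_le_on {μ : Measure ℝ} [IsFiniteMeasure μ] (hμ : ∀ᵐ u ∂μ, |u| ≤ 1)
    {φ : ℝ → ℝ} (hφ : Measurable φ) {B : ℝ} (hB : ∀ u, |u| ≤ 1 → |φ u| ≤ B) : Integrable φ μ :=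
  Integrable.of_bound hφ.aestronglyMeasurable B (hμ.mono fun u hu => hB u hu)

theorem integral_withDensity_one_sub {μ : Measure ℝ} (hμ : ∀ᵐ u ∂μ, |u| ≤ 1) (φ : ℝ → ℝ) :
    ∫ u, φ u ∂(μ.withDensity fun u => ENNReal.ofReal (1 - u)) = ∫ u, φ u * (1 - u) ∂μ := by
  rw [integral_withDensity_eq_integral_toReal_smul measurable_ofReal_one_sub
    (Eventually.of_forall fun _ => ENNReal.ofReal_lt_top)]
  refine integral_congr_ae (hμ.mono fun u hu => ?_)
  simp only [smul_eq_mul]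
  rw [ENNReal.toReal_ofReal (by linarith [(abs_le.1 hu).2]), mul_comm]

theorem integrable_withDensity_one_sub_iff {μ : Measure ℝ} (hμ : ∀ᵐ u ∂μ, |u| ≤ 1) (φ : ℝ → ℝ) :
    Integrable φ (μ.withDensity fun u => ENNReal.ofReal (1 - u)) ↔
      Integrable (fun u => φ u * (1 - u)) μ := by
  rw [integrable_withDensity_iff measurable_ofReal_one_sub
    (Eventually.of_forall fun _ => ENNReal.ofReal_lt_top)]
  refine integrable_congr (hμ.mono fun u hu => ?_)
  simp only
  rw [ENNReal.toReal_ofReal (by linarith [(abs_le.1 hu).2])]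

namespace IsSymmetricLaw

variable {μ ν : Measure ℝ}

theorem integral_neg_mul (hμ : IsSymmetricLaw μ) {φ : ℝ → ℝ} (hφ : Measurable φ) :
    ∫ u, φ (-u) * (1 - u) ∂μ = ∫ u, φ u * (1 - u) ∂μ := by
  rw [← integral_withDensity_one_sub hμ.ae_abs_le φ,
    ← integral_withDensity_one_sub hμ.ae_abs_le fun u => φ (-u)]
  conv_rhs => rw [← hμ.map_neg]
  rw [integral_map measurable_neg.aemeasurable hφ.aestronglyMeasurable]

theorem integrable_neg_mul_iff (hμ : IsSymmetricLaw μ) {φ : ℝ → ℝ} (hφ : Measurable φ) :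
    Integrable (fun u => φ (-u) * (1 - u)) μ ↔ Integrable (fun u => φ u * (1 - u)) μ := by
  rw [← integrable_withDensity_one_sub_iff hμ.ae_abs_le φ,
    ← integrable_withDensity_one_sub_iff hμ.ae_abs_le fun u => φ (-u)]
  conv_rhs => rw [← hμ.map_neg]
  rw [integrable_map_measure hφ.aestronglyMeasurable measurable_neg.aemeasurable]
  rfl

/-- Conditioning a symmetric law on the absolute value. -/
theorem integrable_and_integral_eq (hμ : IsSymmetricLaw μ) {φ : ℝ → ℝ} (hφ : Measurable φ) {B : ℝ}
    (hB : ∀ u, |u| ≤ 1 → |φ u * (1 + u)| ≤ B) :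
    Integrable φ μ ∧
      ∫ u, φ u ∂μ = ∫ u, ((1 + u) / 2 * φ u + (1 - u) / 2 * φ (-u)) ∂μ := by
  have := hμ.isProbabilityMeasure
  have i1 : Integrable (fun u => φ u * (1 + u)) μ :=
    integrable_of_abs_le_on hμ.ae_abs_le (by fun_prop) hB
  have i2 : Integrable (fun u => φ (-u) * (1 - u)) μ :=
    integrable_of_abs_le_on hμ.ae_abs_le (by fun_prop) fun u hu => by
      simpa [sub_eq_add_neg] using hB (-u) ((abs_neg u).trans_le hu)
  -- Only `φ u * (1 + u)` is assumed bounded, which leaves room for a singularity at `-1`.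
  -- Integrability of `φ u * (1 - u)` comes from its bounded reflection by symmetry.
  have i3 := (hμ.integrable_neg_mul_iff hφ).1 i2
  have e : φ = fun u => 1 / 2 * (φ u * (1 + u)) + 1 / 2 * (φ u * (1 - u)) := by
    funext u; ring
  constructor
  · rw [e]
    exact (i1.const_mul _).add (i3.const_mul _)
  · have e' : (fun u => (1 + u) / 2 * φ u + (1 - u) / 2 * φ (-u)) =
        fun u => 1 / 2 * (φ u * (1 + u)) + 1 / 2 * (φ (-u) * (1 - u)) := by
      funext u; ring
    rw [e', integral_add (i1.const_mul _) (i2.const_mul _), integral_const_mul,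
      integral_const_mul, hμ.integral_neg_mul hφ]
    conv_lhs => rw [e]
    rw [integral_add (i1.const_mul _) (i3.const_mul _), integral_const_mul, integral_const_mul]

theorem integral_eq (hμ : IsSymmetricLaw μ) {φ : ℝ → ℝ} (hφ : Measurable φ) {B : ℝ}
    (hB : ∀ u, |u| ≤ 1 → |φ u| ≤ B) :
    ∫ u, φ u ∂μ = ∫ u, ((1 + u) / 2 * φ u + (1 - u) / 2 * φ (-u)) ∂μ := by
  refine (hμ.integrable_and_integral_eq hφ (B := B * 2) fun u hu => ?_).2
  rw [abs_mul]
  have h1 : |1 + u| ≤ 2 := by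
    obtain ⟨h1, h2⟩ := abs_le.1 hu
    rw [abs_le]; constructor <;> linarith
  exact mul_le_mul (hB u hu) h1 (abs_nonneg _) ((abs_nonneg _).trans (hB u hu))

/-- A probability measure on `[-1, 1]` is a symmetric law if the evenness of `(1 - u) μ(du)` holds
against bounded measurable functions. -/
theorem of_integral [IsProbabilityMeasure μ] (hμ : ∀ᵐ u ∂μ, |u| ≤ 1)
    (h : ∀ φ : ℝ → ℝ, Measurable φ → (∀ u, |φ u| ≤ 1) →
      ∫ u, φ (-u) * (1 - u) ∂μ = ∫ u, φ u * (1 - u) ∂μ) : IsSymmetricLaw μ := by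
  refine ⟨inferInstance, hμ, ?_⟩
  have hfin : IsFiniteMeasure (μ.withDensity fun u => ENNReal.ofReal (1 - u)) := by
    apply isFiniteMeasure_withDensity_ofReal
    exact (integrable_of_abs_le_on hμ (φ := fun u => 1 - u) (by fun_prop) (B := 2) fun u hu => by
      obtain ⟨h1, h2⟩ := abs_le.1 hu
      rw [abs_le]; constructor <;> linarith).2
  refine Measure.ext fun E hE => ?_
  have hm : Measurable (E.indicator fun _ => (1 : ℝ)) := measurable_const.indicator hE
  have key := h (E.indicator fun _ => (1 : ℝ)) hm fun u => by
    by_cases hu : u ∈ E <;> simp [hu]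
  rw [← integral_withDensity_one_sub hμ (E.indicator fun _ => (1 : ℝ)),
    ← integral_withDensity_one_sub hμ (fun u => E.indicator (fun _ => (1 : ℝ)) (-u)),
    integral_indicator_const _ hE] at key
  have e : (fun u => E.indicator (fun _ => (1 : ℝ)) (-u)) =
      (Neg.neg ⁻¹' E).indicator fun _ => (1 : ℝ) := rfl
  rw [e, integral_indicator_const _ (measurable_neg hE)] at key
  simp only [smul_eq_mul, mul_one] at key
  rw [Measure.map_apply measurable_neg hE]
  exact (measureReal_eq_measureReal_iff).1 key

theorem prod_ae_abs_le (hμ : IsSymmetricLaw μ) (hν : IsSymmetricLaw ν) :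
    ∀ᵐ p ∂μ.prod ν, |p.1| ≤ 1 ∧ |p.2| ≤ 1 := by
  have := hμ.isProbabilityMeasure
  have := hν.isProbabilityMeasure
  exact (Measure.quasiMeasurePreserving_fst.ae hμ.ae_abs_le).and
    (Measure.quasiMeasurePreserving_snd.ae hν.ae_abs_le)

theorem integrable_prod (hμ : IsSymmetricLaw μ) (hν : IsSymmetricLaw ν) {Φ : ℝ × ℝ → ℝ}
    (hΦ : Measurable Φ) {B : ℝ} (hB : ∀ u v, |u| ≤ 1 → |v| ≤ 1 → |Φ (u, v)| ≤ B) :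
    Integrable Φ (μ.prod ν) := by
  have := hμ.isProbabilityMeasure
  have := hν.isProbabilityMeasure
  exact Integrable.of_bound hΦ.aestronglyMeasurable B
    ((hμ.prod_ae_abs_le hν).mono fun p hp => hB p.1 p.2 hp.1 hp.2)

theorem abs_half_add_le {a b u B : ℝ} (hu : |u| ≤ 1) (ha : |a| ≤ B) (hb : |b| ≤ B) :
    |(1 + u) / 2 * a + (1 - u) / 2 * b| ≤ B := by
  obtain ⟨h1, h2⟩ := abs_le.1 hu
  obtain ⟨h3, h4⟩ := abs_le.1 ha
  obtain ⟨h5, h6⟩ := abs_le.1 hb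
  rw [abs_le]
  constructor <;> nlinarith

theorem integral_prod_half (hμ : IsSymmetricLaw μ) (hν : IsSymmetricLaw ν) {Φ : ℝ × ℝ → ℝ}
    (hΦ : Measurable Φ) {B : ℝ} (hB : ∀ u v, |u| ≤ 1 → |v| ≤ 1 → |Φ (u, v)| ≤ B) :
    ∫ p, Φ p ∂μ.prod ν =
      ∫ p, ((1 + p.2) / 2 * Φ (p.1, p.2) + (1 - p.2) / 2 * Φ (p.1, -p.2)) ∂μ.prod ν := by
  have := hμ.isProbabilityMeasure
  have := hν.isProbabilityMeasure
  have hm : Measurable fun p : ℝ × ℝ =>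
      (1 + p.2) / 2 * Φ (p.1, p.2) + (1 - p.2) / 2 * Φ (p.1, -p.2) := by fun_prop
  rw [integral_prod _ (hμ.integrable_prod hν hΦ hB),
    integral_prod _ (hμ.integrable_prod hν hm (B := B) fun u v hu hv =>
      abs_half_add_le hv (hB u v hu hv) (hB u (-v) hu ((abs_neg v).trans_le hv)))]
  refine integral_congr_ae (hμ.ae_abs_le.mono fun u hu => ?_)
  exact hν.integral_eq (φ := fun v => Φ (u, v)) (by fun_prop) fun v hv => hB u v hu hv

/-- Conditioning a product of symmetric laws on the absolute values. -/
theorem integral_prod_eq (hμ : IsSymmetricLaw μ) (hν : IsSymmetricLaw ν) {Φ : ℝ × ℝ → ℝ}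
    (hΦ : Measurable Φ) {B : ℝ} (hB : ∀ u v, |u| ≤ 1 → |v| ≤ 1 → |Φ (u, v)| ≤ B) :
    ∫ p, Φ p ∂μ.prod ν =
      ∫ p, ((1 + p.1) / 2 * ((1 + p.2) / 2 * Φ (p.1, p.2) + (1 - p.2) / 2 * Φ (p.1, -p.2)) +
        (1 - p.1) / 2 * ((1 + p.2) / 2 * Φ (-p.1, p.2) + (1 - p.2) / 2 * Φ (-p.1, -p.2)))
        ∂μ.prod ν := by
  have := hμ.isProbabilityMeasure
  have := hν.isProbabilityMeasure
  have hm : Measurable fun p : ℝ × ℝ =>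
      (1 + p.2) / 2 * Φ (p.1, p.2) + (1 - p.2) / 2 * Φ (p.1, -p.2) := by fun_prop
  rw [hμ.integral_prod_half hν hΦ hB, ← integral_prod_swap]
  simp only [Prod.fst_swap, Prod.snd_swap]
  rw [hν.integral_prod_half hμ (Φ := fun q => (1 + q.1) / 2 * Φ (q.2, q.1) + (1 - q.1) / 2 * Φ (q.2, -q.1))
      (by fun_prop) (B := B) fun v u hv hu =>
      abs_half_add_le hv (hB u v hu hv) (hB u (-v) hu ((abs_neg v).trans_le hv)),
    ← integral_prod_swap]
  rfl

/-- Average over the four sign patterns of `(u, v)`: as `F` is even, opposite patterns merge, with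
total weights `(1 + u v) / 2` and `(1 - u v) / 2`. -/
theorem integral_tanhAdd_prod (hμ : IsSymmetricLaw μ) (hν : IsSymmetricLaw ν) {F : ℝ → ℝ}
    (hF : Measurable F) (he : ∀ u, F (-u) = F u) {B : ℝ} (hB : ∀ u, |u| ≤ 1 → |F u| ≤ B) :
    ∫ p, F (tanhAdd p.1 p.2) ∂μ.prod ν = ∫ p, vnKernel F p.1 p.2 ∂μ.prod ν := by
  have hm := measurable_tanhAdd
  rw [hμ.integral_prod_eq hν (Φ := fun p => F (tanhAdd p.1 p.2)) (by fun_prop) fun u v hu hv =>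
    hB _ (abs_tanhAdd_le hu hv)]
  refine integral_congr_ae ((hμ.prod_ae_abs_le hν).mono ?_)
  rintro ⟨u, v⟩ ⟨hu, hv⟩
  have key : ∀ a b : ℝ, |a| ≤ 1 → |b| ≤ 1 →
      (1 - a) * (1 - b) * F (tanhAdd (-a) (-b)) = (1 - a) * (1 - b) * F (tanhAdd a b) := by
    intro a b ha hb
    by_cases hab : a * b = -1
    · rw [← one_add_mul_mul_one_sub_tanhAdd ha hb, hab]; ring
    · rw [tanhAdd_neg_neg hab, he]
  have h1 := key u v hu hv
  have h2 := key u (-v) hu ((abs_neg v).trans_le hv)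
  rw [neg_neg] at h2
  simp only [vnKernel]
  linear_combination h1 / 4 + h2 / 4

/-- The variable-node convolution of two symmetric laws is symmetric. -/
theorem map_tanhAdd (hμ : IsSymmetricLaw μ) (hν : IsSymmetricLaw ν) :
    IsSymmetricLaw ((μ.prod ν).map fun p => tanhAdd p.1 p.2) := by
  have := hμ.isProbabilityMeasure
  have := hν.isProbabilityMeasure
  have := Measure.isProbabilityMeasure_map (μ := μ.prod ν) measurable_tanhAdd.aemeasurable
  refine of_integral ?_ fun φ hφ hb => ?_
  · rw [ae_map_iff measurable_tanhAdd.aemeasurable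
      (measurableSet_le (by fun_prop) measurable_const)]
    exact (hμ.prod_ae_abs_le hν).mono fun p hp => abs_tanhAdd_le hp.1 hp.2
  · have hB : ∀ a b u v : ℝ, |a| ≤ 1 → |u| ≤ 1 → |v| ≤ 1 → |a * (1 - tanhAdd u v)| ≤ 1 * 2 := by
      intro a _ u v ha hu hv
      have := abs_le.1 (abs_tanhAdd_le hu hv)
      rw [abs_mul]
      refine mul_le_mul ha ?_ (abs_nonneg _) zero_le_one
      rw [abs_le]; constructor <;> linarith
    rw [integral_map measurable_tanhAdd.aemeasurable (by fun_prop),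
      integral_map measurable_tanhAdd.aemeasurable (by fun_prop)]
    have hm := measurable_tanhAdd
    rw [hμ.integral_prod_eq hν (Φ := fun p => φ (-tanhAdd p.1 p.2) * (1 - tanhAdd p.1 p.2))
        (by fun_prop) fun u v hu hv => hB _ 0 u v (hb _) hu hv,
      hμ.integral_prod_eq hν (Φ := fun p => φ (tanhAdd p.1 p.2) * (1 - tanhAdd p.1 p.2))
        (by fun_prop) fun u v hu hv => hB _ 0 u v (hb _) hu hv]
    refine integral_congr_ae ((hμ.prod_ae_abs_le hν).mono ?_)
    rintro ⟨u, v⟩ ⟨hu, hv⟩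
    -- The pattern `(a, b)` on the left matches `(-a, -b)` on the right: with `s = tanhAdd a b`,
    -- both sides equal `(1 + a b)(1 + s)(1 - s) φ(-s)`.
    have key : ∀ a b : ℝ, |a| ≤ 1 → |b| ≤ 1 →
        (1 + a) * (1 + b) * (φ (-tanhAdd a b) * (1 - tanhAdd a b)) =
          (1 - a) * (1 - b) * (φ (tanhAdd (-a) (-b)) * (1 - tanhAdd (-a) (-b))) := by
      intro a b ha hb
      rw [← one_add_mul_mul_one_sub_tanhAdd ha hb, ← one_add_mul_mul_one_add_tanhAdd ha hb]
      by_cases hab : a * b = -1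
      · rw [hab]; ring
      · rw [tanhAdd_neg_neg hab]; ring
    have hu' := (abs_neg u).trans_le hu
    have hv' := (abs_neg v).trans_le hv
    have h1 := key u v hu hv
    have h2 := key u (-v) hu hv'
    have h3 := key (-u) v hu' hv
    have h4 := key (-u) (-v) hu' hv'
    simp only [neg_neg] at h1 h2 h3 h4
    linear_combination h1 / 4 + h2 / 4 + h3 / 4 + h4 / 4

/-- The check-node convolution of two symmetric laws is symmetric. -/
theorem map_mul (hμ : IsSymmetricLaw μ) (hν : IsSymmetricLaw ν) :
    IsSymmetricLaw ((μ.prod ν).map fun p => p.1 * p.2) := by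
  have := hμ.isProbabilityMeasure
  have := hν.isProbabilityMeasure
  have hm : Measurable fun p : ℝ × ℝ => p.1 * p.2 := by fun_prop
  have := Measure.isProbabilityMeasure_map (μ := μ.prod ν) hm.aemeasurable
  refine of_integral ?_ fun φ hφ hb => ?_
  · rw [ae_map_iff hm.aemeasurable (measurableSet_le (by fun_prop) measurable_const)]
    exact (hμ.prod_ae_abs_le hν).mono fun p hp => abs_mul_le_one hp.1 hp.2
  · have hB : ∀ a u v : ℝ, |a| ≤ 1 → |u| ≤ 1 → |v| ≤ 1 → |a * (1 - u * v)| ≤ 1 * 2 := by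
      intro a u v ha hu hv
      have := abs_le.1 (abs_mul_le_one hu hv)
      rw [abs_mul]
      refine mul_le_mul ha ?_ (abs_nonneg _) zero_le_one
      rw [abs_le]; constructor <;> linarith
    rw [integral_map hm.aemeasurable (by fun_prop), integral_map hm.aemeasurable (by fun_prop),
      hμ.integral_prod_eq hν (Φ := fun p => φ (-(p.1 * p.2)) * (1 - p.1 * p.2))
        (by fun_prop) fun u v hu hv => hB _ u v (hb _) hu hv,
      hμ.integral_prod_eq hν (Φ := fun p => φ (p.1 * p.2) * (1 - p.1 * p.2))
        (by fun_prop) fun u v hu hv => hB _ u v (hb _) hu hv]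
    -- The sign of the product has weights `(1 ± u v) / 2`, and with these the two integrands
    -- already agree pointwise.
    congr 1
    funext p
    simp only [mul_neg, neg_mul, neg_neg]
    ring

end IsSymmetricLaw

/-! ### Moments -/

/-- On bounded support the exponential series may be integrated term by term, so the moments
determine the characteristic function. -/
theorem ext_of_integral_pow {μ ν : Measure ℝ} [IsProbabilityMeasure μ] [IsProbabilityMeasure ν]
    (hμ : ∀ᵐ u ∂μ, |u| ≤ 1) (hν : ∀ᵐ u ∂ν, |u| ≤ 1)
    (h : ∀ n : ℕ, ∫ u, u ^ n ∂μ = ∫ u, u ^ n ∂ν) : μ = ν := by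
  have key : ∀ (ρ : Measure ℝ) [IsProbabilityMeasure ρ], (∀ᵐ u ∂ρ, |u| ≤ 1) → ∀ t : ℝ,
      HasSum (fun n : ℕ => ((t : ℂ) * Complex.I) ^ n / (n.factorial : ℂ) * ((∫ u, u ^ n ∂ρ : ℝ) : ℂ))
        (charFun ρ t) := by
    intro ρ _ hρ t
    rw [charFun_apply_real]
    have hs := hasSum_integral_of_dominated_convergence (μ := ρ)
      (F := fun (n : ℕ) (u : ℝ) => ((t : ℂ) * u * Complex.I) ^ n / (n.factorial : ℂ))
      (f := fun u : ℝ => Complex.exp (t * u * Complex.I))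
      (fun n _ => |t| ^ n / (n.factorial : ℝ))
      (fun n => by fun_prop)
      (fun n => hρ.mono fun u hu => by
        simp only [norm_div, norm_pow, norm_mul, Complex.norm_real, Complex.norm_I, mul_one,
          Real.norm_eq_abs, Complex.norm_natCast]
        gcongr
        exact mul_le_of_le_one_right (abs_nonneg _) hu)
      (Eventually.of_forall fun _ => Real.summable_pow_div_factorial |t|)
      (integrable_const _)
      (Eventually.of_forall fun u => by
        rw [Complex.exp_eq_exp_ℂ]
        exact NormedSpace.expSeries_div_hasSum_exp _)
    refine (congrArg (HasSum · _) (funext fun n => ?_)).mpr hs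
    rw [← integral_complex_ofReal, ← integral_const_mul]
    congr 1
    funext u
    push_cast
    ring
  refine Measure.ext_of_charFun (funext fun t => ?_)
  have h1 := key μ hμ t
  simp only [h] at h1
  exact h1.unique (key ν hν t)

theorem exists_abs_infoGain_le : ∃ B, ∀ w : ℝ, |w| ≤ 1 → |infoGain w| ≤ B := by
  obtain ⟨B, hB⟩ := (isCompact_Icc (a := (-1 : ℝ)) (b := 1)).exists_bound_of_continuousOn
    continuous_infoGain.continuousOn
  exact ⟨B, fun w hw => hB w (abs_le.1 hw)⟩

/-- The even moment `∫ u^{2k+2} μ(du)`. -/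
noncomputable def evenMoment (μ : Measure ℝ) (k : ℕ) : ℝ := ∫ u, u ^ (2 * k + 2) ∂μ

namespace IsSymmetricLaw

variable {μ ν : Measure ℝ}

theorem integrable_pow (hμ : IsSymmetricLaw μ) (n : ℕ) : Integrable (fun u => u ^ n) μ := by
  have := hμ.isProbabilityMeasure
  exact integrable_of_abs_le_on hμ.ae_abs_le (by fun_prop) (B := 1) fun u hu => by
    rw [abs_pow]; exact pow_le_one₀ (abs_nonneg _) hu

/-- The even measure `(1 - u) μ(du)` integrates the odd function `u^(2k+1)` to zero. Hence the even
moments alone determine a symmetric law. -/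
theorem integral_pow_odd (hμ : IsSymmetricLaw μ) (k : ℕ) :
    ∫ u, u ^ (2 * k + 1) ∂μ = evenMoment μ k := by
  have h := hμ.integral_neg_mul (φ := fun u => u ^ (2 * k + 1)) (by fun_prop)
  have e1 : (fun u : ℝ => (-u) ^ (2 * k + 1) * (1 - u)) =
      fun u => u ^ (2 * k + 2) - u ^ (2 * k + 1) := by
    funext u; rw [Odd.neg_pow ⟨k, rfl⟩]; ring
  have e2 : (fun u : ℝ => u ^ (2 * k + 1) * (1 - u)) =
      fun u => u ^ (2 * k + 1) - u ^ (2 * k + 2) := by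
    funext u; ring
  rw [e1, e2, integral_sub (hμ.integrable_pow _) (hμ.integrable_pow _),
    integral_sub (hμ.integrable_pow _) (hμ.integrable_pow _)] at h
  unfold evenMoment
  linarith

theorem ext_of_evenMoment (hμ : IsSymmetricLaw μ) (hν : IsSymmetricLaw ν)
    (h : ∀ k, evenMoment μ k = evenMoment ν k) : μ = ν := by
  have := hμ.isProbabilityMeasure
  have := hν.isProbabilityMeasure
  refine ext_of_integral_pow hμ.ae_abs_le hν.ae_abs_le fun n => ?_
  rcases Nat.even_or_odd' n with ⟨k, rfl | rfl⟩
  · cases k with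
    | zero => simp
    | succ k => exact h k
  · rw [hμ.integral_pow_odd, hν.integral_pow_odd, h]

/-- Each term of the power series is a monomial in `u v`, so its integral factors into moments; this
turns entropy into a bilinear form in the even moments. -/
theorem hasSum_integral_infoGain_mul (hμ : IsSymmetricLaw μ) (hν : IsSymmetricLaw ν) :
    HasSum (fun k => infoCoeff k * (evenMoment μ k * evenMoment ν k))
      (∫ p, infoGain (p.1 * p.2) ∂μ.prod ν) := by
  have := hμ.isProbabilityMeasure
  have := hν.isProbabilityMeasure
  have hs := hasSum_integral_of_dominated_convergence (μ := μ.prod ν)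
    (F := fun (k : ℕ) (p : ℝ × ℝ) => infoCoeff k * (p.1 * p.2) ^ (2 * k + 2))
    (f := fun p => infoGain (p.1 * p.2)) (fun k _ => infoCoeff k)
    (fun k => by fun_prop)
    (fun k => (hμ.prod_ae_abs_le hν).mono fun p hp =>
      norm_infoCoeff_mul_pow_le (abs_mul_le_one hp.1 hp.2) k)
    (Eventually.of_forall fun _ => summable_infoCoeff)
    (integrable_const _)
    ((hμ.prod_ae_abs_le hν).mono fun p hp => hasSum_infoGain (abs_mul_le_one hp.1 hp.2))
  refine (congrArg (HasSum · _) (funext fun k => ?_)).mpr hs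
  rw [integral_const_mul]
  simp only [mul_pow]
  rw [integral_prod_mul (fun u : ℝ => u ^ (2 * k + 2)) fun v : ℝ => v ^ (2 * k + 2)]
  rfl

end IsSymmetricLaw

/-! ### The `tanh` transform of an `L`-density -/

theorem tanhHalf_bot : tanhHalf ⊥ = -1 := by simp [tanhHalf]

theorem tanhHalf_top : tanhHalf ⊤ = 1 := by simp [tanhHalf]

theorem tanhHalf_coe (x : ℝ) : tanhHalf (x : EReal) = Real.tanh (x / 2) := by simp [tanhHalf]

theorem abs_tanhHalf_le (x : EReal) : |tanhHalf x| ≤ 1 := abs_le.2 (tanhHalf_mem x)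

theorem tanhHalf_neg (x : EReal) : tanhHalf (-x) = -tanhHalf x := by
  induction x using EReal.rec with
  | bot => simp [tanhHalf_bot, tanhHalf_top]
  | top => simp [tanhHalf_bot, tanhHalf_top]
  | coe x => rw [← EReal.coe_neg, tanhHalf_coe, tanhHalf_coe, neg_div, Real.tanh_neg]

theorem twoArtanh_tanhHalf (x : EReal) : twoArtanh (tanhHalf x) = x := by
  induction x using EReal.rec with
  | bot => simp [tanhHalf_bot, twoArtanh]
  | top => rw [tanhHalf_top, twoArtanh, if_neg (by norm_num), if_pos le_rfl]
  | coe x =>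
    rw [tanhHalf_coe, twoArtanh, if_neg (not_le.2 (Real.neg_one_lt_tanh _)),
      if_neg (not_le.2 (Real.tanh_lt_one _)), Real.artanh_tanh]
    congr 1; ring

theorem one_add_tanh_half (x : ℝ) : 1 + Real.tanh (x / 2) = 2 / (1 + Real.exp (-x)) := by
  have h1 : Real.exp (-x) = Real.exp (-(x / 2)) / Real.exp (x / 2) := by
    rw [← Real.exp_sub]; congr 1; ring
  rw [Real.tanh_eq_sinh_div_cosh, Real.sinh_eq, Real.cosh_eq, h1]
  have := Real.exp_pos (x / 2)
  have := Real.exp_pos (-(x / 2))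
  field_simp
  ring

theorem one_sub_tanh_half (x : ℝ) :
    1 - Real.tanh (x / 2) = (1 + Real.tanh (x / 2)) * Real.exp (-x) := by
  have h := one_add_tanh_half x
  have h0 := Real.exp_pos (-x)
  have h2 : (1 + Real.tanh (x / 2)) * (1 + Real.exp (-x)) = 2 := by
    rw [h]; field_simp
  linarith

theorem tanhHalf_add (x y : EReal) : tanhHalf (x + y) = tanhAdd (tanhHalf x) (tanhHalf y) := by
  have hb : ∀ v : ℝ, tanhAdd (-1) v = -1 := fun v => by
    unfold tanhAdd
    split_ifs with h
    · rfl
    · rw [div_eq_iff (fun h' => h (by linarith))]; ring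
  have ht : ∀ v : ℝ, v ≠ -1 → tanhAdd 1 v = 1 := fun v hv => by
    unfold tanhAdd
    rw [one_mul, if_neg hv, div_self (fun h' => hv (by linarith))]
  have hr : ∀ r : ℝ, tanhHalf (r : EReal) ≠ -1 := fun r => by
    rw [tanhHalf_coe]; exact (Real.neg_one_lt_tanh _).ne'
  induction x using EReal.rec with
  | bot => rw [EReal.bot_add, tanhHalf_bot, hb]
  | top =>
    induction y using EReal.rec with
    | bot => rw [EReal.add_bot, tanhHalf_bot, tanhAdd_comm, hb]
    | top => rw [EReal.top_add_top, tanhHalf_top, ht _ (by norm_num)]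
    | coe y => rw [EReal.top_add_coe, tanhHalf_top, ht _ (hr y)]
  | coe x =>
    induction y using EReal.rec with
    | bot => rw [EReal.add_bot, tanhHalf_bot, tanhAdd_comm, hb]
    | top => rw [EReal.coe_add_top, tanhHalf_top, tanhAdd_comm, ht _ (hr x)]
    | coe y =>
      rw [← EReal.coe_add, tanhHalf_coe, tanhHalf_coe, tanhHalf_coe]
      have hx := Real.abs_tanh_lt_one (x / 2)
      have hy := Real.abs_tanh_lt_one (y / 2)
      have hne : Real.tanh (x / 2) * Real.tanh (y / 2) ≠ -1 := by
        intro h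
        have : |Real.tanh (x / 2) * Real.tanh (y / 2)| < 1 := by
          rw [abs_mul]; exact mul_lt_one_of_nonneg_of_lt_one_left (abs_nonneg _) hx hy.le
        rw [h] at this; norm_num at this
      have cx := (Real.cosh_pos (x / 2)).ne'
      have cy := (Real.cosh_pos (y / 2)).ne'
      have hne' : 1 + Real.tanh (x / 2) * Real.tanh (y / 2) ≠ 0 := fun h => hne (by linarith)
      have cxy := (Real.cosh_pos (x / 2 + y / 2)).ne'
      rw [tanhAdd, if_neg hne, add_div, eq_div_iff hne', Real.tanh_eq_sinh_div_cosh (x / 2 + y / 2),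
        div_mul_eq_mul_div, div_eq_iff cxy, Real.tanh_eq_sinh_div_cosh,
        Real.tanh_eq_sinh_div_cosh, Real.sinh_add, Real.cosh_add]
      field_simp

/-- An embedding transports integrals of arbitrary integrands, which matters because the test
functions in `Degraded` carry no measurability assumption. -/
theorem measurableEmbedding_tanhHalf : MeasurableEmbedding tanhHalf := by
  refine MeasurableEmbedding.of_measurable_inverse measurable_tanhHalf ?_ measurable_twoArtanh
    twoArtanh_tanhHalf
  have : range tanhHalf = Icc (-1) 1 := by
    ext u
    constructor
    · rintro ⟨x, rfl⟩; exact tanhHalf_mem x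
    · rintro ⟨h1, h2⟩; exact ⟨twoArtanh u, tanhHalf_twoArtanh h1 h2⟩
  rw [this]
  exact measurableSet_Icc

/-- The law of `tanh (y / 2)` under an `L`-density. -/
noncomputable def tanhLaw (c : LDensity) : Measure ℝ := (c : Measure EReal).map tanhHalf

instance isProbabilityMeasure_tanhLaw (c : LDensity) : IsProbabilityMeasure (tanhLaw c) :=
  Measure.isProbabilityMeasure_map measurable_tanhHalf.aemeasurable

theorem tanhLaw_injective : Function.Injective tanhLaw := by
  intro c₁ c₂ h
  refine Subtype.ext ?_
  have key : ∀ c : LDensity, (tanhLaw c).map twoArtanh = c := fun c => by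
    rw [tanhLaw, Measure.map_map measurable_twoArtanh measurable_tanhHalf]
    have : twoArtanh ∘ tanhHalf = id := funext twoArtanh_tanhHalf
    rw [this, Measure.map_id]
  have := congrArg (Measure.map twoArtanh) h
  rwa [key, key] at this

theorem integral_tanhLaw (c : LDensity) (φ : ℝ → ℝ) :
    ∫ u, φ u ∂tanhLaw c = ∫ y, φ (tanhHalf y) ∂(c : Measure EReal) :=
  measurableEmbedding_tanhHalf.integral_map φ

theorem degradationIntegral_eq (f : ℝ → ℝ) (c : LDensity) :
    degradationIntegral f c = ∫ u, f |u| ∂tanhLaw c := (integral_tanhLaw c fun u => f |u|).symm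

theorem tanhLaw_vnConv (c₁ c₂ : LDensity) :
    tanhLaw (vnConv c₁ c₂) = ((tanhLaw c₁).prod (tanhLaw c₂)).map fun p => tanhAdd p.1 p.2 := by
  unfold tanhLaw
  rw [Measure.map_prod_map _ _ measurable_tanhHalf measurable_tanhHalf,
    Measure.map_map measurable_tanhAdd (measurable_tanhHalf.prodMap measurable_tanhHalf)]
  change Measure.map _ (Measure.map _ _) = _
  rw [Measure.map_map (g := tanhHalf) (f := fun p : EReal × EReal => p.1 + p.2)
    measurable_tanhHalf (measurable_fst.add measurable_snd)]
  congr 1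
  funext p
  exact tanhHalf_add p.1 p.2

theorem tanhLaw_cnConv (c₁ c₂ : LDensity) :
    tanhLaw (cnConv c₁ c₂) = ((tanhLaw c₁).prod (tanhLaw c₂)).map fun p => p.1 * p.2 := by
  unfold tanhLaw
  rw [Measure.map_prod_map _ _ measurable_tanhHalf measurable_tanhHalf,
    Measure.map_map (g := fun p : ℝ × ℝ => p.1 * p.2) (measurable_fst.mul measurable_snd)
      (measurable_tanhHalf.prodMap measurable_tanhHalf)]
  change Measure.map _ (Measure.map _ _) = _
  rw [Measure.map_map measurable_tanhHalf measurable_boxOp]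
  congr 1
  funext p
  exact tanhHalf_boxOp p.1 p.2

theorem tanhLaw_deltaZero : tanhLaw deltaZero = Measure.dirac 0 := by
  change Measure.map _ (Measure.dirac 0) = _
  rw [Measure.map_dirac' measurable_tanhHalf, ← EReal.coe_zero, tanhHalf_coe]
  simp

theorem tanhLaw_deltaTop : tanhLaw deltaTop = Measure.dirac 1 := by
  change Measure.map _ (Measure.dirac ⊤) = _
  rw [Measure.map_dirac' measurable_tanhHalf, tanhHalf_top]

theorem ae_abs_le_tanhLaw (c : LDensity) : ∀ᵐ u ∂tanhLaw c, |u| ≤ 1 := by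
  rw [tanhLaw, ae_map_iff measurable_tanhHalf.aemeasurable
    (measurableSet_le (by fun_prop) measurable_const)]
  exact Eventually.of_forall abs_tanhHalf_le

/-- The `tanh` domain form of symmetry of an `L`-density. -/
def HasSymmetricLaw (c : LDensity) : Prop := IsSymmetricLaw (tanhLaw c)

theorem hasSymmetricLaw_deltaZero : HasSymmetricLaw deltaZero := by
  refine IsSymmetricLaw.of_integral (ae_abs_le_tanhLaw _) fun φ hφ _ => ?_
  rw [tanhLaw_deltaZero, integral_dirac, integral_dirac, neg_zero]

theorem hasSymmetricLaw_deltaTop : HasSymmetricLaw deltaTop := by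
  refine IsSymmetricLaw.of_integral (ae_abs_le_tanhLaw _) fun φ hφ _ => ?_
  rw [tanhLaw_deltaTop, integral_dirac, integral_dirac]; simp

theorem HasSymmetricLaw.vnConv {c₁ c₂ : LDensity} (h₁ : HasSymmetricLaw c₁)
    (h₂ : HasSymmetricLaw c₂) : HasSymmetricLaw (vnConv c₁ c₂) := by
  unfold HasSymmetricLaw
  rw [tanhLaw_vnConv]
  exact IsSymmetricLaw.map_tanhAdd h₁ h₂

theorem HasSymmetricLaw.cnConv {c₁ c₂ : LDensity} (h₁ : HasSymmetricLaw c₁)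
    (h₂ : HasSymmetricLaw c₂) : HasSymmetricLaw (cnConv c₁ c₂) := by
  unfold HasSymmetricLaw
  rw [tanhLaw_cnConv]
  exact IsSymmetricLaw.map_mul h₁ h₂

/-! ### From symmetry on the extended line to symmetry of the `tanh` law. -/

theorem measurable_exp_neg : Measurable fun y : EReal => EReal.exp (-y) :=
  EReal.measurable_exp.comp measurable_neg

/-- Take `E = {⊤}` in the definition of symmetry: the density `e^{-y}` is zero at `⊤`. -/
theorem IsSymmetric.measure_bot {c : LDensity} (hc : IsSymmetric c) :
    (c : Measure EReal) {⊥} = 0 := by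
  have h := hc {⊤} (measurableSet_singleton _) (by simp)
  have e : Neg.neg ⁻¹' {(⊤ : EReal)} = {⊥} := by
    ext x; simp
  rw [e] at h
  rw [h, lintegral_singleton]; simp

theorem IsSymmetric.lintegral_neg {c : LDensity} (hc : IsSymmetric c) {G : EReal → ENNReal}
    (hG : Measurable G) (h0 : G ⊥ = 0) :
    ∫⁻ y, G (-y) ∂(c : Measure EReal) = ∫⁻ y, G y * EReal.exp (-y) ∂(c : Measure EReal) := by
  have hs : MeasurableSet ({⊥}ᶜ : Set EReal) := (measurableSet_singleton _).compl
  have hm : ((c : Measure EReal).map Neg.neg).restrict {⊥}ᶜ =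
      ((c : Measure EReal).withDensity fun y => EReal.exp (-y)).restrict {⊥}ᶜ := by
    refine Measure.ext fun E hE => ?_
    rw [Measure.restrict_apply hE, Measure.restrict_apply hE,
      Measure.map_apply measurable_neg (hE.inter hs), withDensity_apply _ (hE.inter hs),
      hc _ (hE.inter hs) (by simp)]
  have e : G = ({⊥}ᶜ : Set EReal).indicator G := by
    funext y
    by_cases hy : y = ⊥
    · simp [hy, h0]
    · rw [indicator_of_mem]; simpa using hy
  have key : ∫⁻ y, G y ∂((c : Measure EReal).map Neg.neg) =
      ∫⁻ y, G y ∂((c : Measure EReal).withDensity fun y => EReal.exp (-y)) := by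
    rw [e, lintegral_indicator hs, lintegral_indicator hs, hm]
  rw [lintegral_map hG measurable_neg, lintegral_withDensity_eq_lintegral_mul _
    measurable_exp_neg hG] at key
  rw [key]
  congr 1
  funext y
  exact mul_comm _ _

theorem ofReal_one_add_tanhHalf_mul_exp {y : EReal} (hy : y ≠ ⊥) :
    ENNReal.ofReal (1 + tanhHalf y) * EReal.exp (-y) = ENNReal.ofReal (1 - tanhHalf y) := by
  induction y using EReal.rec with
  | bot => exact absurd rfl hy
  | top => simp [tanhHalf_top]
  | coe y =>
    rw [← EReal.coe_neg, EReal.exp_coe, tanhHalf_coe, ← ENNReal.ofReal_mul, one_sub_tanh_half]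
    linarith [Real.neg_one_lt_tanh (y / 2)]

theorem IsSymmetric.hasSymmetricLaw {c : LDensity} (hc : IsSymmetric c) : HasSymmetricLaw c := by
  refine ⟨inferInstance, ae_abs_le_tanhLaw c, Measure.ext fun E hE => ?_⟩
  have key : ∀ A : Set ℝ, MeasurableSet A →
      (tanhLaw c).withDensity (fun u => ENNReal.ofReal (1 - u)) A =
        ∫⁻ y, A.indicator 1 (tanhHalf y) * ENNReal.ofReal (1 - tanhHalf y)
          ∂(c : Measure EReal) := fun A hA => by
    have hm := measurable_ofReal_one_sub
    rw [withDensity_apply _ hA, ← lintegral_indicator hA, tanhLaw,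
      lintegral_map (measurable_ofReal_one_sub.indicator hA) measurable_tanhHalf]
    congr 1
    funext y
    by_cases hy : tanhHalf y ∈ A <;> simp [hy]
  rw [Measure.map_apply measurable_neg hE, key _ hE, key _ (measurable_neg hE)]
  have hmt := measurable_tanhHalf
  have hmi : Measurable (E.indicator (1 : ℝ → ENNReal)) := measurable_one.indicator hE
  -- The weight `1 + u` vanishes at `⊥`, and both reflection and multiplication by `e^{-y} = (1 - u)
  -- / (1 + u)` turn it into `1 - u`.
  have h := hc.lintegral_neg
    (G := fun y => E.indicator 1 (tanhHalf y) * ENNReal.ofReal (1 + tanhHalf y))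
    (by fun_prop) (by simp [tanhHalf_bot])
  simp only [tanhHalf_neg] at h
  refine Eq.trans ?_ (h.trans ?_)
  · rfl
  · refine lintegral_congr_ae ?_
    have hb : ∀ᵐ y ∂(c : Measure EReal), y ≠ ⊥ := by
      rw [ae_iff]; simpa using hc.measure_bot
    filter_upwards [hb] with y hy
    rw [mul_assoc, ofReal_one_add_tanhHalf_mul_exp hy]

/-! ### Entropy -/

/-- The entropy kernel in the `tanh` domain. -/
noncomputable def tanhEntropyKernel (u : ℝ) : ℝ :=
  if u = -1 then 0 else 1 - Real.log (1 + u) / Real.log 2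

theorem measurable_tanhEntropyKernel : Measurable tanhEntropyKernel := by
  unfold tanhEntropyKernel
  exact Measurable.ite (measurableSet_singleton (-1 : ℝ)) measurable_const (by fun_prop)

theorem tanhEntropyKernel_tanhHalf (y : EReal) : tanhEntropyKernel (tanhHalf y) = entropyKernel y := by
  have h2 : Real.log 2 ≠ 0 := (Real.log_pos one_lt_two).ne'
  induction y using EReal.rec with
  | bot => simp [tanhEntropyKernel, entropyKernel, tanhHalf_bot]
  | top =>
    rw [tanhHalf_top, tanhEntropyKernel, if_neg (by norm_num), one_add_one_eq_two, div_self h2]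
    simp [entropyKernel]
  | coe y =>
    have h0 := Real.exp_pos (-y)
    rw [tanhHalf_coe, tanhEntropyKernel, if_neg (Real.neg_one_lt_tanh _).ne', one_add_tanh_half,
      Real.log_div two_ne_zero (by positivity)]
    simp only [entropyKernel, EReal.coe_ne_bot, EReal.coe_ne_top, or_self, if_false,
      EReal.toReal_coe, Real.logb]
    field_simp
    ring

theorem one_add_mul_tanhEntropyKernel (u : ℝ) :
    (1 + u) * tanhEntropyKernel u = (1 + u) - (1 + u) * Real.log (1 + u) / Real.log 2 := by
  unfold tanhEntropyKernel
  split_ifs with h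
  · simp [h]
  · ring

/-- The kernel `1 - log₂ (1 + u)` is unbounded near `-1`, but its product with `1 + u` is bounded,
and averaging it over `±u` with weights `(1 ± u) / 2` gives `1 - infoGain u / log 2`. -/
theorem entropy_eq {c : LDensity} (hc : HasSymmetricLaw c) :
    entropy c = 1 - (∫ u, infoGain u ∂tanhLaw c) / Real.log 2 := by
  obtain ⟨B, hB⟩ := exists_abs_infoGain_le
  have hcont : Continuous fun u : ℝ =>
      (1 + u) + Real.negMulLog (1 + u) / Real.log 2 := by fun_prop
  obtain ⟨B', hB'⟩ := (isCompact_Icc (a := (-1 : ℝ)) (b := 1)).exists_bound_of_continuousOn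
    hcont.continuousOn
  have h1 : entropy c = ∫ u, tanhEntropyKernel u ∂tanhLaw c := by
    rw [integral_tanhLaw]
    simp only [tanhEntropyKernel_tanhHalf]
    rfl
  have h2 := (hc.integrable_and_integral_eq measurable_tanhEntropyKernel (B := B') fun u hu => by
    refine le_trans (le_of_eq ?_) (hB' u (abs_le.1 hu))
    rw [mul_comm, one_add_mul_tanhEntropyKernel, Real.norm_eq_abs, Real.negMulLog]
    congr 1; ring).2
  rw [h1, h2]
  have e : (fun u => (1 + u) / 2 * tanhEntropyKernel u + (1 - u) / 2 * tanhEntropyKernel (-u)) =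
      fun u => 1 - infoGain u / Real.log 2 := by
    funext u
    have k1 := one_add_mul_tanhEntropyKernel u
    have k2 := one_add_mul_tanhEntropyKernel (-u)
    rw [← sub_eq_add_neg] at k2
    unfold infoGain
    linear_combination k1 / 2 + k2 / 2
  rw [e, integral_sub (integrable_const _) ((integrable_of_abs_le_on hc.ae_abs_le
    continuous_infoGain.measurable hB).div_const _), integral_div]
  simp

theorem entropy_cnConv {c₁ c₂ : LDensity} (h₁ : HasSymmetricLaw c₁) (h₂ : HasSymmetricLaw c₂) :
    entropy (cnConv c₁ c₂) =
      1 - (∫ p, infoGain (p.1 * p.2) ∂(tanhLaw c₁).prod (tanhLaw c₂)) / Real.log 2 := by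
  rw [entropy_eq (h₁.cnConv h₂), tanhLaw_cnConv, integral_map (by fun_prop)
    continuous_infoGain.aestronglyMeasurable]

/-- The duality rule `H(a ⊛ b) + H(a ⊠ b) = H(a) + H(b)`. -/
theorem entropy_vnConv_add_entropy_cnConv {c₁ c₂ : LDensity} (h₁ : HasSymmetricLaw c₁)
    (h₂ : HasSymmetricLaw c₂) :
    entropy (vnConv c₁ c₂) + entropy (cnConv c₁ c₂) = entropy c₁ + entropy c₂ := by
  obtain ⟨B, hB⟩ := exists_abs_infoGain_le
  have hm := continuous_infoGain.measurable
  have i1 := IsSymmetricLaw.integrable_prod h₁ h₂ (Φ := fun p => infoGain p.1) (by fun_prop)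
    fun u v hu hv => hB u hu
  have i2 := IsSymmetricLaw.integrable_prod h₁ h₂ (Φ := fun p => infoGain p.2) (by fun_prop)
    fun u v hu hv => hB v hv
  have i3 := IsSymmetricLaw.integrable_prod h₁ h₂ (Φ := fun p => infoGain (p.1 * p.2))
    (by fun_prop) fun u v hu hv => hB _ (abs_mul_le_one hu hv)
  have key : ∫ p, vnKernel infoGain p.1 p.2 ∂(tanhLaw c₁).prod (tanhLaw c₂) =
      ∫ p, (infoGain p.1 + infoGain p.2 - infoGain (p.1 * p.2))
        ∂(tanhLaw c₁).prod (tanhLaw c₂) := by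
    refine integral_congr_ae ((IsSymmetricLaw.prod_ae_abs_le h₁ h₂).mono fun p hp => ?_)
    have := infoGain_tanhAdd_add_infoGain_mul hp.1 hp.2
    simp only [vnKernel]
    linarith
  have e1 : ∫ p, infoGain p.1 ∂(tanhLaw c₁).prod (tanhLaw c₂) = ∫ u, infoGain u ∂tanhLaw c₁ := by
    simpa using integral_fun_fst (μ := tanhLaw c₁) (ν := tanhLaw c₂) infoGain
  have e2 : ∫ p, infoGain p.2 ∂(tanhLaw c₁).prod (tanhLaw c₂) = ∫ u, infoGain u ∂tanhLaw c₂ := by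
    simpa using integral_fun_snd (μ := tanhLaw c₁) (ν := tanhLaw c₂) infoGain
  rw [entropy_cnConv h₁ h₂, entropy_eq (h₁.vnConv h₂), entropy_eq h₁, entropy_eq h₂,
    tanhLaw_vnConv, integral_map measurable_tanhAdd.aemeasurable
    continuous_infoGain.aestronglyMeasurable,
    IsSymmetricLaw.integral_tanhAdd_prod h₁ h₂ hm infoGain_neg hB, key,
    integral_sub (f := fun p : ℝ × ℝ => infoGain p.1 + infoGain p.2) (i1.add i2) i3,
    integral_add i1 i2, e1, e2]
  ring

/-- The second difference of the entropy of a variable-node convolution, as a series. -/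
theorem hasSum_entropy_vnConv {a a' b b' : LDensity} (ha : HasSymmetricLaw a)
    (ha' : HasSymmetricLaw a') (hb : HasSymmetricLaw b) (hb' : HasSymmetricLaw b') :
    HasSum (fun k => infoCoeff k *
        ((evenMoment (tanhLaw a') k - evenMoment (tanhLaw a) k) *
          (evenMoment (tanhLaw b') k - evenMoment (tanhLaw b) k)))
      (Real.log 2 * (entropy (vnConv a' b') - entropy (vnConv a' b) - entropy (vnConv a b') +
        entropy (vnConv a b))) := by
  have h2 : Real.log 2 ≠ 0 := (Real.log_pos one_lt_two).ne'
  have s1 := IsSymmetricLaw.hasSum_integral_infoGain_mul ha' hb'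
  have s2 := IsSymmetricLaw.hasSum_integral_infoGain_mul ha' hb
  have s3 := IsSymmetricLaw.hasSum_integral_infoGain_mul ha hb'
  have s4 := IsSymmetricLaw.hasSum_integral_infoGain_mul ha hb
  have s := ((s1.sub s2).sub s3).add s4
  -- Duality trades `⊠` for `⊛` at the cost of the single entropies, which cancel in the second
  -- difference.
  have d : ∀ {x y : LDensity}, HasSymmetricLaw x → HasSymmetricLaw y →
      ∫ p, infoGain (p.1 * p.2) ∂(tanhLaw x).prod (tanhLaw y) =
        Real.log 2 * (1 - entropy x - entropy y + entropy (vnConv x y)) := by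
    intro x y hx hy
    have k1 := entropy_vnConv_add_entropy_cnConv hx hy
    rw [entropy_cnConv hx hy] at k1
    field_simp at k1
    linear_combination -k1
  rw [d ha' hb', d ha' hb, d ha hb', d ha hb] at s
  have e : Real.log 2 * (entropy (vnConv a' b') - entropy (vnConv a' b) - entropy (vnConv a b') +
        entropy (vnConv a b)) = Real.log 2 * (1 - entropy a' - entropy b' + entropy (vnConv a' b')) -
        Real.log 2 * (1 - entropy a' - entropy b + entropy (vnConv a' b)) -
        Real.log 2 * (1 - entropy a - entropy b' + entropy (vnConv a b')) +
        Real.log 2 * (1 - entropy a - entropy b + entropy (vnConv a b)) := by ring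
  rw [e]
  exact (congrArg (HasSum · _) (funext fun k => by ring)).mpr s

/-! ### Degradation -/

/-- Clamping the argument to `[0, 1]` makes `f` globally antitone, hence measurable, and bounded by
its end values. -/
theorem exists_measurable_bounded_eqOn {f : ℝ → ℝ} (hf : AntitoneOn f (Icc 0 1)) :
    ∃ g : ℝ → ℝ, Measurable g ∧ (∃ B, ∀ u, |g u| ≤ B) ∧ EqOn f g (Icc 0 1) := by
  have hm : ∀ u : ℝ, max 0 (min u 1) ∈ Icc (0 : ℝ) 1 := fun u =>
    ⟨le_max_left _ _, max_le zero_le_one (min_le_right _ _)⟩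
  refine ⟨fun u => f (max 0 (min u 1)), ?_, ⟨max |f 1| |f 0|, fun u => ?_⟩, fun u hu => ?_⟩
  · have : Antitone fun u : ℝ => f (max 0 (min u 1)) := fun x y hxy =>
      hf (hm x) (hm y) (by gcongr)
    exact this.measurable
  · have h1 := hf (hm u) (right_mem_Icc.2 zero_le_one) (hm u).2
    have h2 := hf (left_mem_Icc.2 zero_le_one) (hm u) (hm u).1
    exact abs_le_max_abs_abs h1 h2
  · simp only
    rw [min_eq_left hu.2, max_eq_right hu.1]

theorem degradationIntegral_congr {f g : ℝ → ℝ} (h : EqOn f g (Icc 0 1)) (c : LDensity) :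
    degradationIntegral f c = degradationIntegral g c :=
  integral_congr_ae (Eventually.of_forall fun y => h ⟨abs_nonneg _, abs_tanhHalf_le y⟩)

/-- Degradation only has to be tested on bounded measurable functions. -/
theorem Degraded.of_bounded {c₁ c₂ : LDensity}
    (h : ∀ (f : ℝ → ℝ) (B : ℝ), Measurable f → (∀ u, |f u| ≤ B) → ConcaveOn ℝ (Icc 0 1) f →
      AntitoneOn f (Icc 0 1) → degradationIntegral f c₂ ≤ degradationIntegral f c₁) :
    Degraded c₁ c₂ := by
  intro f hf ha
  obtain ⟨g, hg, ⟨B, hB⟩, he⟩ := exists_measurable_bounded_eqOn ha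
  rw [degradationIntegral_congr he, degradationIntegral_congr he]
  exact h g B hg hB (hf.congr he) (ha.congr he)

theorem Degraded.refl (c : LDensity) : Degraded c c := fun _ _ _ => le_rfl

theorem Degraded.trans {c₁ c₂ c₃ : LDensity} (h₁ : Degraded c₁ c₂) (h₂ : Degraded c₂ c₃) :
    Degraded c₁ c₃ := fun f hf ha => (h₂ f hf ha).trans (h₁ f hf ha)

theorem integrable_comp_abs_tanhLaw (c : LDensity) {f : ℝ → ℝ} {B : ℝ} (hf : Measurable f)
    (hB : ∀ u, |f u| ≤ B) : Integrable (fun u => f |u|) (tanhLaw c) :=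
  integrable_of_abs_le_on (ae_abs_le_tanhLaw c) (by fun_prop) fun u _ => hB |u|

theorem degraded_deltaZero_left (c : LDensity) : Degraded deltaZero c := by
  refine .of_bounded fun f B hf hB _ ha => ?_
  rw [degradationIntegral_eq, degradationIntegral_eq, tanhLaw_deltaZero, integral_dirac, abs_zero]
  calc ∫ u, f |u| ∂tanhLaw c ≤ ∫ _, f 0 ∂tanhLaw c :=
        integral_mono_ae (integrable_comp_abs_tanhLaw c hf hB) (integrable_const _)
          ((ae_abs_le_tanhLaw c).mono fun u hu =>
            ha (left_mem_Icc.2 zero_le_one) ⟨abs_nonneg _, hu⟩ (abs_nonneg _))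
    _ = f 0 := by simp

theorem degraded_deltaTop_right (c : LDensity) : Degraded c deltaTop := by
  refine .of_bounded fun f B hf hB _ ha => ?_
  rw [degradationIntegral_eq, degradationIntegral_eq, tanhLaw_deltaTop, integral_dirac, abs_one]
  calc f 1 = ∫ _, f 1 ∂tanhLaw c := by simp
    _ ≤ ∫ u, f |u| ∂tanhLaw c :=
        integral_mono_ae (integrable_const _) (integrable_comp_abs_tanhLaw c hf hB)
          ((ae_abs_le_tanhLaw c).mono fun u hu =>
            ha ⟨abs_nonneg _, hu⟩ (right_mem_Icc.2 zero_le_one) hu)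

/-- By Fubini it suffices to compare for fixed `v`, where the slice of `K` is itself a test function
for degradation. -/
theorem integral_prod_le_of_degraded {a a' d : LDensity} (ha : HasSymmetricLaw a)
    (ha' : HasSymmetricLaw a') (hd : HasSymmetricLaw d) (h : Degraded a a') {K : ℝ → ℝ → ℝ} {B : ℝ}
    (hK : Measurable fun p : ℝ × ℝ => K p.1 p.2) (hB : ∀ u v, |u| ≤ 1 → |v| ≤ 1 → |K u v| ≤ B)
    (he : ∀ u v, K |u| v = K u v) (hc : ∀ v, |v| ≤ 1 → ConcaveOn ℝ (Icc 0 1) (K · v))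
    (hm : ∀ v, |v| ≤ 1 → AntitoneOn (K · v) (Icc 0 1)) :
    ∫ p, K p.1 p.2 ∂(tanhLaw a').prod (tanhLaw d) ≤
      ∫ p, K p.1 p.2 ∂(tanhLaw a).prod (tanhLaw d) := by
  have i1 := IsSymmetricLaw.integrable_prod ha hd hK hB
  have i2 := IsSymmetricLaw.integrable_prod ha' hd hK hB
  rw [integral_prod_symm _ i1, integral_prod_symm _ i2]
  refine integral_mono_ae i2.integral_prod_right i1.integral_prod_right
    (hd.ae_abs_le.mono fun v hv => ?_)
  have := h (K · v) (hc v hv) (hm v hv)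
  rw [degradationIntegral_eq, degradationIntegral_eq] at this
  simpa only [he] using this

theorem Degraded.vnConv_right {a a' d : LDensity} (ha : HasSymmetricLaw a)
    (ha' : HasSymmetricLaw a') (hd : HasSymmetricLaw d) (h : Degraded a a') :
    Degraded (vnConv a d) (vnConv a' d) := by
  refine .of_bounded fun f B hf hB hc hm => ?_
  have hF : Measurable fun u : ℝ => f |u| := by fun_prop
  have key : ∀ {x : LDensity}, HasSymmetricLaw x → degradationIntegral f (vnConv x d) =
      ∫ p, vnKernel (fun u => f |u|) p.1 p.2 ∂(tanhLaw x).prod (tanhLaw d) := fun {x} hx => by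
    rw [degradationIntegral_eq, tanhLaw_vnConv, integral_map measurable_tanhAdd.aemeasurable
      hF.aestronglyMeasurable]
    exact IsSymmetricLaw.integral_tanhAdd_prod hx hd (F := fun u => f |u|) (by fun_prop)
      (fun u => by simp) (B := B) fun u _ => hB _
  rw [key ha, key ha']
  refine integral_prod_le_of_degraded ha ha' hd h (B := B) ?_ (fun u v hu hv => ?_)
    (fun u v => ?_) (fun v hv => (concaveOn_antitoneOn_vnKernel hc hm hv).1)
    (fun v hv => (concaveOn_antitoneOn_vnKernel hc hm hv).2)
  · have h1 := measurable_tanhAdd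
    have h2 : Measurable fun p : ℝ × ℝ => tanhAdd p.1 (-p.2) :=
      h1.comp (measurable_fst.prodMk measurable_snd.neg)
    unfold vnKernel
    fun_prop
  · exact IsSymmetricLaw.abs_half_add_le (abs_mul_le_one hu hv) (hB _) (hB _)
  · rcases abs_choice u with h | h <;> rw [h]
    exact vnKernel_neg fun x => by simp

theorem Degraded.cnConv_right {a a' d : LDensity} (ha : HasSymmetricLaw a)
    (ha' : HasSymmetricLaw a') (hd : HasSymmetricLaw d) (h : Degraded a a') :
    Degraded (cnConv a d) (cnConv a' d) := by
  refine .of_bounded fun f B hf hB hc hm => ?_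
  have hF : Measurable fun u : ℝ => f |u| := by fun_prop
  have key : ∀ x : LDensity, degradationIntegral f (cnConv x d) =
      ∫ p, f (|p.1| * |p.2|) ∂(tanhLaw x).prod (tanhLaw d) := fun x => by
    rw [degradationIntegral_eq, tanhLaw_cnConv, integral_map (by fun_prop)
      hF.aestronglyMeasurable]
    simp only [abs_mul]
  rw [key a, key a']
  have hlt : ∀ v : ℝ, |v| ≤ 1 → EqOn (fun u => f (u * |v|)) (fun u => f (|u| * |v|)) (Icc 0 1) :=
    fun v _ u hu => by simp only [abs_of_nonneg hu.1]
  exact integral_prod_le_of_degraded ha ha' hd h (K := fun u v => f (|u| * |v|)) (B := B)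
    (by fun_prop) (fun u v _ _ => hB _) (fun u v => by rw [abs_abs])
    (fun v hv => (concaveOn_antitoneOn_comp_mul hc hm hv).1.congr (hlt v hv))
    (fun v hv => (concaveOn_antitoneOn_comp_mul hc hm hv).2.congr (hlt v hv))

theorem Degraded.vnConv {a a' b b' : LDensity} (ha : HasSymmetricLaw a) (ha' : HasSymmetricLaw a')
    (hb : HasSymmetricLaw b) (hb' : HasSymmetricLaw b') (h₁ : Degraded a a') (h₂ : Degraded b b') :
    Degraded (vnConv a b) (vnConv a' b') := by
  refine (h₁.vnConv_right ha ha' hb).trans ?_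
  rw [Std.Commutative.comm (op := DensityEvolution.vnConv) a' b,
    Std.Commutative.comm (op := DensityEvolution.vnConv) a' b']
  exact h₂.vnConv_right hb hb' ha'

theorem Degraded.cnConv {a a' b b' : LDensity} (ha : HasSymmetricLaw a) (ha' : HasSymmetricLaw a')
    (hb : HasSymmetricLaw b) (hb' : HasSymmetricLaw b') (h₁ : Degraded a a') (h₂ : Degraded b b') :
    Degraded (cnConv a b) (cnConv a' b') := by
  refine (h₁.cnConv_right ha ha' hb).trans ?_
  rw [Std.Commutative.comm (op := DensityEvolution.cnConv) a' b,
    Std.Commutative.comm (op := DensityEvolution.cnConv) a' b']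
  exact h₂.cnConv_right hb hb' ha'

/-! ### Even moments under degradation. -/

theorem degradationIntegral_even_poly {c : LDensity} (hc : HasSymmetricLaw c) (C D : ℝ) (k : ℕ) :
    degradationIntegral (fun u => D * u ^ (2 * k + 2) - C * u ^ 2) c =
      D * evenMoment (tanhLaw c) k - C * evenMoment (tanhLaw c) 0 := by
  have e : ∀ (u : ℝ) (k : ℕ), |u| ^ (2 * k + 2) = u ^ (2 * k + 2) := fun u k =>
    Even.pow_abs ⟨k + 1, by ring⟩ u
  rw [degradationIntegral_eq]
  have e0 : ∀ u : ℝ, |u| ^ 2 = u ^ (2 * 0 + 2) := fun u => by simp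
  simp only [e, e0]
  rw [integral_sub ((hc.integrable_pow _).const_mul _) ((hc.integrable_pow _).const_mul _),
    integral_const_mul, integral_const_mul]
  rfl

theorem concaveOn_even_poly {C D : ℝ} {k : ℕ}
    (h : ∀ x : ℝ, |x| ≤ 1 → D * ((2 * k + 2) * ((2 * k + 1) * x ^ (2 * k))) ≤ 2 * C) :
    ConcaveOn ℝ (Icc (-1) 1) fun u : ℝ => D * u ^ (2 * k + 2) - C * u ^ 2 := by
  refine concaveOn_of_hasDerivWithinAt2_nonpos (convex_Icc _ _) (by fun_prop)
    (f' := fun x => D * ((2 * k + 2) * x ^ (2 * k + 1)) - C * (2 * x))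
    (f'' := fun x => D * ((2 * k + 2) * ((2 * k + 1) * x ^ (2 * k))) - C * 2)
    (fun x _ => ?_) (fun x _ => ?_) (fun x hx => ?_)
  · have h1 := ((hasDerivAt_pow (2 * k + 2) x).const_mul D).sub ((hasDerivAt_pow 2 x).const_mul C)
    convert! h1.hasDerivWithinAt using 1
    push_cast
    simp
  · have h1 := (((hasDerivAt_pow (2 * k + 1) x).const_mul (2 * (k : ℝ) + 2)).const_mul D).sub
      (((hasDerivAt_id x).const_mul 2).const_mul C)
    convert! h1.hasDerivWithinAt using 1
    push_cast
    simp
  · have hx' : x ∈ Icc (-1 : ℝ) 1 := interior_subset hx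
    have := h x (abs_le.2 hx')
    linarith

/-- The hypothesis on `C` and `D` says that the second derivative of `D u^(2k+2) - C u²` is
nonpositive; an even concave function is antitone on `[0, 1]`. Below, `D = -1` orders the moments
and `D = 1` with large `C` gives rigidity. -/
theorem Degraded.even_poly_le {a b : LDensity} (ha : HasSymmetricLaw a) (hb : HasSymmetricLaw b)
    (h : Degraded a b) {C D : ℝ} {k : ℕ}
    (hCD : ∀ x : ℝ, |x| ≤ 1 → D * ((2 * k + 2) * ((2 * k + 1) * x ^ (2 * k))) ≤ 2 * C) :
    D * evenMoment (tanhLaw b) k - C * evenMoment (tanhLaw b) 0 ≤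
      D * evenMoment (tanhLaw a) k - C * evenMoment (tanhLaw a) 0 := by
  have hc := concaveOn_even_poly hCD
  rw [← degradationIntegral_even_poly ha, ← degradationIntegral_even_poly hb]
  refine h _ (hc.subset (Icc_subset_Icc (by norm_num) le_rfl) (convex_Icc _ _))
    (antitoneOn_of_concaveOn_of_even hc fun u => ?_)
  rw [Even.neg_pow ⟨k + 1, by ring⟩, neg_sq]

theorem Degraded.evenMoment_le {a b : LDensity} (ha : HasSymmetricLaw a) (hb : HasSymmetricLaw b)
    (h : Degraded a b) (k : ℕ) : evenMoment (tanhLaw a) k ≤ evenMoment (tanhLaw b) k := by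
  have := h.even_poly_le ha hb (C := 0) (D := -1) (k := k) fun x _ => by
    have : 0 ≤ x ^ (2 * k) := Even.pow_nonneg ⟨k, by ring⟩ x
    have : 0 ≤ (2 * (k : ℝ) + 2) * ((2 * k + 1) * x ^ (2 * k)) := by positivity
    linarith
  linarith

/-- Comparable symmetric densities with the same second moment are equal. -/
theorem Degraded.eq_of_evenMoment_zero {a b : LDensity} (ha : HasSymmetricLaw a)
    (hb : HasSymmetricLaw b) (h : Degraded a b)
    (h0 : evenMoment (tanhLaw a) 0 = evenMoment (tanhLaw b) 0) : a = b := by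
  refine tanhLaw_injective (IsSymmetricLaw.ext_of_evenMoment ha hb fun k =>
    le_antisymm (h.evenMoment_le ha hb k) ?_)
  -- This `C` dominates the second derivative of `u^(2k+2)` on `[-1, 1]`. Equal second moments
  -- cancel the `C` terms, leaving the reverse moment inequality.
  have := h.even_poly_le ha hb (C := (2 * k + 2) * (2 * k + 1)) (D := 1) (k := k) fun x hx => by
    have h1 : x ^ (2 * k) ≤ 1 := by
      rw [← Even.pow_abs ⟨k, by ring⟩ x]
      exact pow_le_one₀ (abs_nonneg _) hx
    have h2 : (0 : ℝ) ≤ (2 * k + 2) * (2 * k + 1) := by positivity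
    nlinarith
  rw [h0] at this
  linarith

/-- The second difference of the entropy of a variable-node convolution along degraded pairs is
positive exactly if both pairs are strictly degraded. -/
theorem entropy_vnConv_second_difference_pos_iff {a a' b b' : LDensity} (ha : HasSymmetricLaw a)
    (ha' : HasSymmetricLaw a') (hb : HasSymmetricLaw b) (hb' : HasSymmetricLaw b')
    (h₁ : Degraded a a') (h₂ : Degraded b b' ∨ Degraded b' b) :
    0 < entropy (vnConv a' b') - entropy (vnConv a' b) - entropy (vnConv a b') +
        entropy (vnConv a b) ↔ StrictlyDegraded a a' ∧ StrictlyDegraded b b' := by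
  have hs := hasSum_entropy_vnConv ha ha' hb hb'
  have hl : 0 < Real.log 2 := Real.log_pos one_lt_two
  have hma := fun k => sub_nonneg.2 (h₁.evenMoment_le ha ha' k)
  constructor
  · intro hpos
    have hpos' := mul_pos hl hpos
    by_cases hab : a = a'
    · subst hab
      simp at hpos
    by_cases hbb : b = b'
    · subst hbb
      have := lt_of_lt_of_eq hpos (by ring : _ = (0 : ℝ))
      exact absurd this (lt_irrefl _)
    rcases h₂ with h₂ | h₂
    · exact ⟨⟨h₁, hab⟩, h₂, hbb⟩
    -- If the second pair is ordered the other way, every term of the series is nonpositive.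
    · have hle := hs.nonpos fun k => mul_nonpos_of_nonneg_of_nonpos (infoCoeff_pos k).le
        (mul_nonpos_of_nonneg_of_nonpos (hma k) (sub_nonpos.2 (h₂.evenMoment_le hb' hb k)))
      linarith
  · rintro ⟨⟨-, hab⟩, h₂, hbb⟩
    have hmb := fun k => sub_nonneg.2 (h₂.evenMoment_le hb hb' k)
    -- All terms are nonnegative, so strictness of the term `k = 0` suffices, and that is the second
    -- moment rigidity.
    have h0a := lt_of_le_of_ne (hma 0) fun h =>
      hab (h₁.eq_of_evenMoment_zero ha ha' (by linarith))
    have h0b := lt_of_le_of_ne (hmb 0) fun h =>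
      hbb (h₂.eq_of_evenMoment_zero hb hb' (by linarith))
    have hle := le_hasSum hs 0 fun k _ =>
      mul_nonneg (infoCoeff_pos k).le (mul_nonneg (hma k) (hmb k))
    exact pos_of_mul_pos_right (lt_of_lt_of_le (mul_pos (infoCoeff_pos 0) (mul_pos h0a h0b)) hle)
      hl.le

end DensityEvolution

namespace DensityEvolution

/-! ### Density evolution -/

/-! ### Iterated convolutions: symmetry and monotonicity. -/

section Convolutions

variable {ι : Type*} [DecidableEq ι]

theorem insert_sdiff_self {s : Finset ι} {i : ι} (hi : i ∈ s) : insert i (s \ {i}) = s := by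
  rw [Finset.sdiff_singleton_eq_erase, Finset.insert_erase hi]

theorem vnConvs_insert {s : Finset ι} {i : ι} (hi : i ∉ s) (a : ι → LDensity) :
    vnConvs (insert i s) a = vnConv (a i) (vnConvs s a) := Finset.fold_insert hi

theorem cnConvs_insert {s : Finset ι} {i : ι} (hi : i ∉ s) (a : ι → LDensity) :
    cnConvs (insert i s) a = cnConv (a i) (cnConvs s a) := Finset.fold_insert hi

theorem vnConvs_eq {s : Finset ι} {i : ι} (hi : i ∈ s) (a : ι → LDensity) :
    vnConvs s a = vnConv (a i) (vnConvs (s \ {i}) a) := by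
  rw [← vnConvs_insert (by simp), insert_sdiff_self hi]

theorem cnConvs_eq {s : Finset ι} {i : ι} (hi : i ∈ s) (a : ι → LDensity) :
    cnConvs s a = cnConv (a i) (cnConvs (s \ {i}) a) := by
  rw [← cnConvs_insert (by simp), insert_sdiff_self hi]

theorem hasSymmetricLaw_vnConvs (s : Finset ι) {a : ι → LDensity} (ha : ∀ i, HasSymmetricLaw (a i)) :
    HasSymmetricLaw (vnConvs s a) := by
  induction s using Finset.induction_on with
  | empty => exact hasSymmetricLaw_deltaZero
  | insert i s hi ih => rw [vnConvs_insert hi]; exact (ha i).vnConv ih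

theorem hasSymmetricLaw_cnConvs (s : Finset ι) {a : ι → LDensity} (ha : ∀ i, HasSymmetricLaw (a i)) :
    HasSymmetricLaw (cnConvs s a) := by
  induction s using Finset.induction_on with
  | empty => exact hasSymmetricLaw_deltaTop
  | insert i s hi ih => rw [cnConvs_insert hi]; exact (ha i).cnConv ih

theorem degraded_vnConvs (s : Finset ι) {a b : ι → LDensity} (ha : ∀ i, HasSymmetricLaw (a i))
    (hb : ∀ i, HasSymmetricLaw (b i)) (h : ∀ i, Degraded (a i) (b i)) :
    Degraded (vnConvs s a) (vnConvs s b) := by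
  induction s using Finset.induction_on with
  | empty => exact .refl _
  | insert i s hi ih =>
    rw [vnConvs_insert hi, vnConvs_insert hi]
    exact (h i).vnConv (ha i) (hb i) (hasSymmetricLaw_vnConvs s ha) (hasSymmetricLaw_vnConvs s hb) ih

theorem degraded_cnConvs (s : Finset ι) {a b : ι → LDensity} (ha : ∀ i, HasSymmetricLaw (a i))
    (hb : ∀ i, HasSymmetricLaw (b i)) (h : ∀ i, Degraded (a i) (b i)) :
    Degraded (cnConvs s a) (cnConvs s b) := by
  induction s using Finset.induction_on with
  | empty => exact .refl _
  | insert i s hi ih =>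
    rw [cnConvs_insert hi, cnConvs_insert hi]
    exact (h i).cnConv (ha i) (hb i) (hasSymmetricLaw_cnConvs s ha) (hasSymmetricLaw_cnConvs s hb) ih

end Convolutions

theorem vnConv_vnConvs_eq {V C : Type*} [DecidableEq V] [Fintype C] [DecidableEq C]
    {G : FactorGraph V C} (c : V → LDensity) (m : Messages V C) {i : V} {α : C}
    (h : (i, α) ∈ G.edges) :
    vnConv (c i) (vnConvs (G.nbrV i) fun β => m.c2v β i) =
      vnConv (m.c2v α i) (extrinsic G c m i α) := by
  rw [vnConvs_eq (i := α) (by simp [FactorGraph.nbrV, h]), extrinsic]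
  ac_rfl

/-! ### Invariants of the message densities along a schedule. -/

section Messages

variable {V C : Type*} [Fintype V] [DecidableEq V] [Fintype C] [DecidableEq C]

theorem passMessage_c2v_apply (G : FactorGraph V C) (c : V → LDensity) (m : Messages V C) {α : C}
    {i : V} (h : (i, α) ∈ G.edges) (β : C) (j : V) :
    (passMessage G c m (.c2v α i h)).c2v β j =
      if β = α ∧ j = i then c2vUpdate G m α i else m.c2v β j := by
  simp only [passMessage, Function.update_apply]
  by_cases h1 : β = α
  · subst h1
    by_cases h2 : j = i <;> simp [h2]
  · simp [h1]

theorem passMessage_v2c_apply (G : FactorGraph V C) (c : V → LDensity) (m : Messages V C) {α : C}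
    {i : V} (h : (i, α) ∈ G.edges) (j : V) (β : C) :
    (passMessage G c m (.v2c i α h)).v2c j β =
      if j = i ∧ β = α then v2cUpdate G c m i α else m.v2c j β := by
  simp only [passMessage, Function.update_apply]
  by_cases h1 : j = i
  · subst h1
    by_cases h2 : β = α <;> simp [h2]
  · simp [h1]

/-- Facts about the message densities that every schedule preserves: they are symmetric, and
updating any one of them can only improve it. -/
structure Messages.IsAdmissible (G : FactorGraph V C) (c : V → LDensity) (m : Messages V C) :
    Prop where
  symm_c2v : ∀ α i, HasSymmetricLaw (m.c2v α i)
  symm_v2c : ∀ i α, HasSymmetricLaw (m.v2c i α)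
  degraded_c2v : ∀ α i, Degraded (m.c2v α i) (c2vUpdate G m α i)
  degraded_v2c : ∀ i α, Degraded (m.v2c i α) (v2cUpdate G c m i α)
  known : ∀ i ∈ G.known, ∀ α, m.v2c i α = deltaZero ∨ m.v2c i α = deltaTop

namespace Messages.IsAdmissible

variable {G : FactorGraph V C} {c : V → LDensity} {m : Messages V C}

theorem initial (G : FactorGraph V C) (c : V → LDensity) :
    (initialMessages V C).IsAdmissible G c where
  symm_c2v _ _ := hasSymmetricLaw_deltaZero
  symm_v2c _ _ := hasSymmetricLaw_deltaZero
  degraded_c2v _ _ := degraded_deltaZero_left _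
  degraded_v2c _ _ := degraded_deltaZero_left _
  known _ _ _ := .inl rfl

theorem symm_c2vUpdate (hm : m.IsAdmissible G c) (α : C) (i : V) :
    HasSymmetricLaw (c2vUpdate G m α i) :=
  hasSymmetricLaw_cnConvs _ fun j => hm.symm_v2c j α

theorem symm_extrinsic (hm : m.IsAdmissible G c) (hc : ∀ i, IsSymmetric (c i)) (i : V) (α : C) :
    HasSymmetricLaw (extrinsic G c m i α) :=
  (hc i).hasSymmetricLaw.vnConv (hasSymmetricLaw_vnConvs _ fun β => hm.symm_c2v β i)

theorem symm_v2cUpdate (hm : m.IsAdmissible G c) (hc : ∀ i, IsSymmetric (c i)) (i : V) (α : C) :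
    HasSymmetricLaw (v2cUpdate G c m i α) := by
  unfold v2cUpdate
  split_ifs
  · exact hasSymmetricLaw_deltaTop
  · exact hm.symm_extrinsic hc i α

/-- At a known node the update is `Δ_∞` rather than the extrinsic density, so monotonicity of
updates is silent; comparability holds because the message is one of the two extremes. -/
theorem degraded_extrinsic (hm : m.IsAdmissible G c) (i : V) (α : C) :
    Degraded (m.v2c i α) (extrinsic G c m i α) ∨ Degraded (extrinsic G c m i α) (m.v2c i α) := by
  by_cases hi : i ∈ G.known
  · rcases hm.known i hi α with h | h <;> rw [h]
    · exact .inl (degraded_deltaZero_left _)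
    · exact .inr (degraded_deltaTop_right _)
  · have h := hm.degraded_v2c i α
    rw [v2cUpdate, if_neg hi] at h
    exact .inl h

/-- Check-node updates read only variable-to-check messages and so do not move, while variable-node
updates improve by monotonicity of `⊛`. The other direction is the same with `⊠`. -/
theorem passMessage_c2v (hm : m.IsAdmissible G c) (hc : ∀ i, IsSymmetric (c i)) {α : C} {i : V}
    (h : (i, α) ∈ G.edges) : (passMessage G c m (.c2v α i h)).IsAdmissible G c := by
  have hs : ∀ β j, HasSymmetricLaw ((passMessage G c m (.c2v α i h)).c2v β j) := fun β j => by
    rw [passMessage_c2v_apply]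
    split_ifs
    · exact hm.symm_c2vUpdate α i
    · exact hm.symm_c2v β j
  have hd : ∀ β j, Degraded (m.c2v β j) ((passMessage G c m (.c2v α i h)).c2v β j) := fun β j => by
    rw [passMessage_c2v_apply]
    split_ifs with h'
    · rw [h'.1, h'.2]; exact hm.degraded_c2v α i
    · exact .refl _
  refine ⟨hs, hm.symm_v2c, fun β j => ?_, fun j β => (hm.degraded_v2c j β).trans ?_, hm.known⟩
  · change Degraded _ (c2vUpdate G m β j)
    rw [passMessage_c2v_apply]
    split_ifs with h'
    · rw [h'.1, h'.2]; exact .refl _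
    · exact hm.degraded_c2v β j
  · unfold v2cUpdate
    split_ifs
    · exact .refl _
    · exact (Degraded.refl _).vnConv (hc j).hasSymmetricLaw (hc j).hasSymmetricLaw
        (hasSymmetricLaw_vnConvs _ fun γ => hm.symm_c2v γ j)
        (hasSymmetricLaw_vnConvs _ fun γ => hs γ j)
        (degraded_vnConvs _ (fun γ => hm.symm_c2v γ j) (fun γ => hs γ j) fun γ => hd γ j)

theorem passMessage_v2c (hm : m.IsAdmissible G c) (hc : ∀ i, IsSymmetric (c i)) {α : C} {i : V}
    (h : (i, α) ∈ G.edges) : (passMessage G c m (.v2c i α h)).IsAdmissible G c := by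
  have hs : ∀ j β, HasSymmetricLaw ((passMessage G c m (.v2c i α h)).v2c j β) := fun j β => by
    rw [passMessage_v2c_apply]
    split_ifs
    · exact hm.symm_v2cUpdate hc i α
    · exact hm.symm_v2c j β
  have hd : ∀ j β, Degraded (m.v2c j β) ((passMessage G c m (.v2c i α h)).v2c j β) := fun j β => by
    rw [passMessage_v2c_apply]
    split_ifs with h'
    · rw [h'.1, h'.2]; exact hm.degraded_v2c i α
    · exact .refl _
  refine ⟨hm.symm_c2v, hs, fun β j => (hm.degraded_c2v β j).trans ?_, fun j β => ?_,
    fun j hj β => ?_⟩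
  · exact degraded_cnConvs _ (fun γ => hm.symm_v2c γ β) (fun γ => hs γ β) fun γ => hd γ β
  · change Degraded _ (v2cUpdate G c m j β)
    rw [passMessage_v2c_apply]
    split_ifs with h'
    · rw [h'.1, h'.2]; exact .refl _
    · exact hm.degraded_v2c j β
  · rw [passMessage_v2c_apply]
    split_ifs with h'
    · rw [v2cUpdate, if_pos (h'.1 ▸ hj)]; exact .inr rfl
    · exact hm.known j hj β

theorem messagesAt (hc : ∀ i, IsSymmetric (c i)) (S : Schedule G) (t : ℕ) :
    (messagesAt G c S t).IsAdmissible G c := by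
  unfold DensityEvolution.messagesAt
  generalize S.take t = L
  generalize hm₀ : initialMessages V C = m₀
  have hm : m₀.IsAdmissible G c := hm₀ ▸ initial G c
  clear hm₀
  induction L generalizing m₀ with
  | nil => exact hm
  | cons s L ih =>
    refine ih _ ?_
    cases s with
    | c2v α i h => exact hm.passMessage_c2v hc h
    | v2c i α h => exact hm.passMessage_v2c hc h

end Messages.IsAdmissible

/-! ### The change of the potential under a single message. -/

/-- `-N U` as a function of the current messages. -/
noncomputable def potential (G : FactorGraph V C) (c : V → LDensity) (m : Messages V C) : ℝ :=
  (∑ i, entropy (vnConv (c i) (vnConvs (G.nbrV i) fun α => m.c2v α i)))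
    + (∑ α, ∑ i ∈ G.nbrC α, entropy (m.v2c i α))
    - (∑ α, entropy (cnConvs (G.nbrC α) fun i => m.v2c i α))
    - ∑ e ∈ G.edges, entropy (vnConv (m.v2c e.1 e.2) (m.c2v e.2 e.1))

theorem gap_lt_gap_iff (G : FactorGraph V C) (c : V → LDensity) (S : Schedule G) (t t' : ℕ) (i : V) :
    gap G c S t < gap G c S t' ↔
      0 < potential G c (messagesAt G c S t) - potential G c (messagesAt G c S t') := by
  have hN : (0 : ℝ) < Fintype.card V := by
    have : Nonempty V := ⟨i⟩
    exact_mod_cast Fintype.card_pos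
  have h : -1 / (Fintype.card V : ℝ) < 0 := div_neg_of_neg_of_pos (by norm_num) hN
  change -1 / (Fintype.card V : ℝ) * potential G c _ < -1 / (Fintype.card V : ℝ) * potential G c _ ↔ _
  rw [mul_lt_mul_left_of_neg h, sub_pos]

theorem sum_sub_sum_eq_of_forall_ne {ι : Type*} {s : Finset ι} {f g : ι → ℝ} {i : ι} (hi : i ∈ s)
    (h : ∀ j ∈ s, j ≠ i → f j = g j) : ∑ j ∈ s, f j - ∑ j ∈ s, g j = f i - g i := by
  rw [← Finset.sum_sub_distrib]
  exact Finset.sum_eq_single i (fun j hj hji => sub_eq_zero.2 (h j hj hji)) fun h' => absurd hi h'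

/-- Only the node term at `i` and the edge term at `(i, α)` move; they convolve the changed message
with the extrinsic density and with the opposite message, respectively. -/
theorem potential_passMessage_c2v_sub (G : FactorGraph V C) (c : V → LDensity) (m : Messages V C)
    {i : V} {α : C} (h : (i, α) ∈ G.edges) :
    potential G c (passMessage G c m (.c2v α i h)) - potential G c m =
      entropy (vnConv (c2vUpdate G m α i) (extrinsic G c m i α)) -
        entropy (vnConv (c2vUpdate G m α i) (m.v2c i α)) -
        entropy (vnConv (m.c2v α i) (extrinsic G c m i α)) +
        entropy (vnConv (m.c2v α i) (m.v2c i α)) := by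
  set m' := passMessage G c m (.c2v α i h) with hm'
  have hv : m'.v2c = m.v2c := rfl
  have hne : ∀ β j, ¬(β = α ∧ j = i) → m'.c2v β j = m.c2v β j := fun β j hj => by
    rw [hm', passMessage_c2v_apply, if_neg hj]
  have heq : m'.c2v α i = c2vUpdate G m α i := by
    rw [hm', passMessage_c2v_apply, if_pos ⟨rfl, rfl⟩]
  have hext : extrinsic G c m' i α = extrinsic G c m i α := by
    unfold extrinsic vnConvs
    congr 1
    refine Finset.fold_congr fun β hβ => hne β i fun h' => ?_
    simp [h'.1] at hβ
  have h1 := sum_sub_sum_eq_of_forall_ne (Finset.mem_univ i)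
    (f := fun j => entropy (vnConv (c j) (vnConvs (G.nbrV j) fun β => m'.c2v β j)))
    (g := fun j => entropy (vnConv (c j) (vnConvs (G.nbrV j) fun β => m.c2v β j)))
    (fun j _ hj => by simp only [fun β => hne β j fun h' => hj h'.2])
  have h2 := sum_sub_sum_eq_of_forall_ne h
    (f := fun e => entropy (vnConv (m'.v2c e.1 e.2) (m'.c2v e.2 e.1)))
    (g := fun e => entropy (vnConv (m.v2c e.1 e.2) (m.c2v e.2 e.1)))
    (fun e _ he => by
      simp only [hv]; rw [hne _ _ fun h' => he (Prod.ext h'.2 h'.1)])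
  simp only [vnConv_vnConvs_eq c _ h, hext, heq, hv] at h1 h2
  rw [Std.Commutative.comm (op := vnConv) (m.v2c i α),
    Std.Commutative.comm (op := vnConv) (m.v2c i α)] at h2
  unfold potential
  simp only [hv]
  linarith

/-- The terms at `α` contain `H(x) - H(x ⊠ b)`, with `x` the changed message and `b` the check-node
update. By duality this is `H(x ⊛ b) - H(b)`, and `H(b)` cancels because `b` does not involve `x`.
-/
theorem potential_passMessage_v2c_sub {G : FactorGraph V C} {c : V → LDensity} {m : Messages V C}
    (hm : m.IsAdmissible G c) (hc : ∀ i, IsSymmetric (c i)) {i : V} {α : C}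
    (h : (i, α) ∈ G.edges) :
    potential G c (passMessage G c m (.v2c i α h)) - potential G c m =
      entropy (vnConv (v2cUpdate G c m i α) (c2vUpdate G m α i)) -
        entropy (vnConv (v2cUpdate G c m i α) (m.c2v α i)) -
        entropy (vnConv (m.v2c i α) (c2vUpdate G m α i)) +
        entropy (vnConv (m.v2c i α) (m.c2v α i)) := by
  have d1 := entropy_vnConv_add_entropy_cnConv (hm.symm_v2cUpdate hc i α) (hm.symm_c2vUpdate α i)
  have d2 := entropy_vnConv_add_entropy_cnConv (hm.symm_v2c i α) (hm.symm_c2vUpdate α i)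
  set m' := passMessage G c m (.v2c i α h) with hm'
  have hv : m'.c2v = m.c2v := rfl
  have hne : ∀ j β, ¬(j = i ∧ β = α) → m'.v2c j β = m.v2c j β := fun β j hj => by
    rw [hm', passMessage_v2c_apply, if_neg hj]
  have heq : m'.v2c i α = v2cUpdate G c m i α := by
    rw [hm', passMessage_v2c_apply, if_pos ⟨rfl, rfl⟩]
  have hmem : i ∈ G.nbrC α := by simp [FactorGraph.nbrC, h]
  have hupd : c2vUpdate G m' α i = c2vUpdate G m α i := by
    unfold c2vUpdate cnConvs
    refine Finset.fold_congr fun j hj => hne j α fun h' => ?_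
    simp [h'.1] at hj
  have h0 := sum_sub_sum_eq_of_forall_ne hmem
    (f := fun j => entropy (m'.v2c j α)) (g := fun j => entropy (m.v2c j α))
    (fun j _ hj => by simp only [hne j α fun h' => hj h'.1])
  have h1 := sum_sub_sum_eq_of_forall_ne (Finset.mem_univ α)
    (f := fun β => ∑ j ∈ G.nbrC β, entropy (m'.v2c j β))
    (g := fun β => ∑ j ∈ G.nbrC β, entropy (m.v2c j β))
    (fun β _ hβ => by simp only [fun j => hne j β fun h' => hβ h'.2])
  have h2 := sum_sub_sum_eq_of_forall_ne (Finset.mem_univ α)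
    (f := fun β => entropy (cnConvs (G.nbrC β) fun j => m'.v2c j β))
    (g := fun β => entropy (cnConvs (G.nbrC β) fun j => m.v2c j β))
    (fun β _ hβ => by simp only [fun j => hne j β fun h' => hβ h'.2])
  have h3 := sum_sub_sum_eq_of_forall_ne h
    (f := fun e => entropy (vnConv (m'.v2c e.1 e.2) (m'.c2v e.2 e.1)))
    (g := fun e => entropy (vnConv (m.v2c e.1 e.2) (m.c2v e.2 e.1)))
    (fun e _ he => by
      simp only [hv]; rw [hne _ _ fun h' => he (Prod.ext h'.1 h'.2)])
  have hcn : ∀ n : Messages V C, cnConvs (G.nbrC α) (fun j => n.v2c j α) =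
      cnConv (n.v2c i α) (c2vUpdate G n α i) := fun n => cnConvs_eq hmem _
  simp only [hcn, hupd, heq, hv] at h0 h1 h2 h3
  unfold potential
  simp only [hv]
  linarith

theorem messagesAt_succ (G : FactorGraph V C) (c : V → LDensity) (S : Schedule G) {t : ℕ}
    {s : DirectedEdge G} (hs : S[t]? = some s) :
    messagesAt G c S (t + 1) = passMessage G c (messagesAt G c S t) s := by
  unfold messagesAt
  rw [List.take_add_one, hs, List.foldl_append]
  rfl

end Messages

end DensityEvolution

theorem mainTheorem3 {V C : Type*} [Fintype V] [DecidableEq V] [Fintype C] [DecidableEq C]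
    (G : FactorGraph V C) (c : V → LDensity) (hc : ∀ i, IsSymmetric (c i))
    (S : Schedule G) (t : ℕ) (ht : 1 ≤ t) :
    (∀ (α : C) (i : V) (h : (i, α) ∈ G.edges), S[t - 1]? = some (.c2v α i h) →
      (gap G c S t < gap G c S (t - 1) ↔
        StrictlyDegraded ((messagesAt G c S (t - 1)).c2v α i) ((messagesAt G c S t).c2v α i) ∧
        StrictlyDegraded ((messagesAt G c S (t - 1)).v2c i α)
          (vnConv (c i)
            (vnConvs (G.nbrV i \ {α}) fun h => (messagesAt G c S (t - 1)).c2v h i)))) ∧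
    (∀ (i : V) (α : C) (h : (i, α) ∈ G.edges), S[t - 1]? = some (.v2c i α h) →
      (gap G c S t < gap G c S (t - 1) ↔
        StrictlyDegraded ((messagesAt G c S (t - 1)).v2c i α) ((messagesAt G c S t).v2c i α) ∧
        StrictlyDegraded ((messagesAt G c S (t - 1)).c2v α i)
          (cnConvs (G.nbrC α \ {i}) fun j => (messagesAt G c S (t - 1)).v2c j α))) := by
  obtain ⟨t, rfl⟩ := Nat.exists_eq_add_of_le' ht
  rw [Nat.add_sub_cancel]
  have hm := Messages.IsAdmissible.messagesAt hc S t
  refine ⟨fun α i h hS => ?_, fun i α h hS => ?_⟩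
  · rw [gap_lt_gap_iff G c S _ _ i, messagesAt_succ G c S hS, potential_passMessage_c2v_sub,
      passMessage_c2v_apply, if_pos ⟨rfl, rfl⟩]
    exact entropy_vnConv_second_difference_pos_iff (hm.symm_c2v α i) (hm.symm_c2vUpdate α i)
      (hm.symm_v2c i α) (hm.symm_extrinsic hc i α) (hm.degraded_c2v α i) (hm.degraded_extrinsic i α)
  · rw [gap_lt_gap_iff G c S _ _ i, messagesAt_succ G c S hS, potential_passMessage_v2c_sub hm hc,
      passMessage_v2c_apply, if_pos ⟨rfl, rfl⟩]
    exact entropy_vnConv_second_difference_pos_iff (hm.symm_v2c i α) (hm.symm_v2cUpdate hc i α)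
      (hm.symm_c2v α i) (hm.symm_c2vUpdate α i) (hm.degraded_v2c i α)
      (.inl (hm.degraded_c2v α i))
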